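/- For natural numbers $n,d\ge 1$ let $S(n,d)=\mathrm{Mat}_{n\times d}(\mathbb C)\times \mathrm{Mat}_{d\times n}(\mathbb C)$, with elements $(A,B)$. For $\ell\ge1$ put $$r^\ell=\tfrac12\sum_{1\le j<k\le \ell}\bigl(E_{jk}\otimes E_{kj}-E_{kj}\otimes E_{jk}\bigr),\qquad r^\ell_+=r^\ell+\tfrac12\sum_{j,k=1}^{\ell}E_{jk}\otimes E_{kj},$$ and fix $\kappa\in\mathbb C\setminus\{0\}$. In the usual tensor notation ($X_1=X\otimes 1$, $X_2=1\otimes X$), the holomorphic Poisson bracket $\{\ ,\ \}_\kappa$ on $S(n,d)$ is determined by $$\{A_1,A_2\}_\kappa=-\kappa(r^nA_1A_2+A_1A_2r^d),\qquad \{B_1,B_2\}_\kappa=-\kappa(B_1B_2r^n+r^dB_1B_2),$$ $$\{A_1,B_2\}_\kappa=\kappa\Bigl(B_2r^n_+A_1+A_1r^d_+B_2+\sum_{i=1}^n\sum_{\alpha=1}^dE_{i\alpha}\otimes E_{\alpha i}\Bigr).$$ For $(a,b)\in S(n,1)$ put $G_j=1+\sum_{k=j}^na_kb_k$ for $1\le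 j\le n$ and $G_{n+1}=1$. Where all $\operatorname{Re}G_j>0$, define, with principal square roots, the upper triangular matrix $g_+(a,b)$ and the lower triangular matrix $g_-^{-1}(a,b)$, the inverse of $g_-(a,b)$, by $$(g_+)_{jj}=(g_-^{-1})_{jj}=\sqrt{G_j/G_{j+1}},\qquad (g_+)_{jk}=\frac{a_jb_k}{\sqrt{G_kG_{k+1}}}\ (j<k),\qquad (g_-^{-1})_{jk}=\frac{a_jb_k}{\sqrt{G_jG_{j+1}}}\ (j>k).$$ Theorem. Let $n,d>1$. Take $d$ copies of $S(n,1)$, with elements $(a^\alpha,b^\alpha)$, $\alpha=1,\dots,d$, each with the bracket $\{\ ,\ \}_\kappa$, and give the product $S(n,1)^{d}$ the product Poisson structure. Let $\Omega\subset S(n,1)^{d}$ be the open neighborhood of $0$ on which $\operatorname{Re}G_j(a^\alpha,b^\alpha)>0$ for all $j$ and $\alpha$. Define $m:\Omega\to S(n,d)$, $(a,b)\mapsto(A,B)$, by giving the columns $A^\alpha$ of $A$ and the rows $B^\alpha$ of $B$: $A^1=a^1$, $B^1=b^1$ and, for $\alpha\ge2$, $$A^\alpha=g_+(a^1,b^1)\cdots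 g_+(a^{\alpha-1},b^{\alpha-1})\,a^\alpha,\qquad B^\alpha=b^\alpha\, g_-^{-1}(a^{\alpha-1},b^{\alpha-1})\cdots g_-^{-1}(a^1,b^1).$$ Then $m$ maps $\Omega$ biholomorphically onto an open neighborhood of $m(0)=0$ in $S(n,d)$, and it is a Poisson map: for all $p\in\Omega$ and all functions $f,h$ holomorphic near $m(p)$, the product bracket of $f\circ m$ and $h\circ m$ at $p$ equals $\{f,h\}_\kappa(m(p))$. Moreover, on $\Omega$ the matrices $\mathcal G_\pm(a,b)=g_\pm(a^1,b^1)\cdots g_\pm(a^d,b^d)$ are invertible and $$\mathbf 1_n+A(a,b)B(a,b)=\mathcal G_+(a,b)\,\mathcal G_-(a,b)^{-1}.$$ -/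

import Mathlib

open scoped Kronecker

attribute [local instance] Matrix.normedAddCommGroup Matrix.normedSpace

/-- The complex vector space `S(n,d) = Mat_{n×d}(ℂ) × Mat_{d×n}(ℂ)`, with elements `(A, B)`
(equipped with the entrywise sup norm, i.e. with its standard topology). -/
abbrev S (n d : ℕ) : Type := Matrix (Fin n) (Fin d) ℂ × Matrix (Fin d) (Fin n) ℂ

namespace S

noncomputable section

/-! ### The Poisson bracket -/

/-- The Drinfeld–Jimbo `r`-matrix `r = ½ ∑_{j<k} E_{jk} ∧ E_{kj}`, with `X ∧ Y = X ⊗ Y - Y ⊗ X`. -/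
def rMat (l : ℕ) : Matrix (Fin l × Fin l) (Fin l × Fin l) ℂ :=
  (1 / 2 : ℂ) • ∑ j : Fin l, ∑ k ∈ Finset.Ioi j,
    (Matrix.single j k (1 : ℂ) ⊗ₖ Matrix.single k j (1 : ℂ)
      - Matrix.single k j (1 : ℂ) ⊗ₖ Matrix.single j k (1 : ℂ))

/-- The tensor `I = ∑_{j,k} E_{jk} ⊗ E_{kj}`. -/
def iMat (l : ℕ) : Matrix (Fin l × Fin l) (Fin l × Fin l) ℂ :=
  ∑ j : Fin l, ∑ k : Fin l, Matrix.single j k (1 : ℂ) ⊗ₖ Matrix.single k j (1 : ℂ)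

/-- `r_+ = r + ½ I`. -/
def rPlus (l : ℕ) : Matrix (Fin l × Fin l) (Fin l × Fin l) ℂ :=
  rMat l + (1 / 2 : ℂ) • iMat l

/-- `C₁₂ = ∑_{i,α} E_{iα} ⊗ E_{αi}`. -/
def cMat (n d : ℕ) : Matrix (Fin n × Fin d) (Fin d × Fin n) ℂ :=
  ∑ i : Fin n, ∑ α : Fin d, Matrix.single i α (1 : ℂ) ⊗ₖ Matrix.single α i (1 : ℂ)

variable {n d : ℕ}

/-- `{A₁, A₂}_κ`; the bracket `{A_{iα}, A_{jβ}}_κ` is its entry at row `(i,j)`, column `(α,β)`.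
Here `A₁ A₂ = A ⊗ A`. -/
def brAA (κ : ℂ) (x : S n d) : Matrix (Fin n × Fin n) (Fin d × Fin d) ℂ :=
  -κ • (rMat n * (x.1 ⊗ₖ x.1) + (x.1 ⊗ₖ x.1) * rMat d)

/-- `{B₁, B₂}_κ`; the bracket `{B_{αi}, B_{βj}}_κ` is its entry at row `(α,β)`, column `(i,j)`. -/
def brBB (κ : ℂ) (x : S n d) : Matrix (Fin d × Fin d) (Fin n × Fin n) ℂ :=
  -κ • ((x.2 ⊗ₖ x.2) * rMat n + rMat d * (x.2 ⊗ₖ x.2))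

/-- `{A₁, B₂}_κ`; the bracket `{A_{iα}, B_{βj}}_κ` is its entry at row `(i,β)`, column `(α,j)`.
Here `A₁ = A ⊗ 1` and `B₂ = 1 ⊗ B`, with identity matrices of the fitting sizes. -/
def brAB (κ : ℂ) (x : S n d) : Matrix (Fin n × Fin d) (Fin d × Fin n) ℂ :=
  κ • (((1 : Matrix (Fin n) (Fin n) ℂ) ⊗ₖ x.2) * rPlus n * (x.1 ⊗ₖ (1 : Matrix (Fin n) (Fin n) ℂ))
    + (x.1 ⊗ₖ (1 : Matrix (Fin d) (Fin d) ℂ)) * rPlus d * ((1 : Matrix (Fin d) (Fin d) ℂ) ⊗ₖ x.2)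
    + cMat n d)

/-- The tangent vector `∂/∂A_{iα}` of `S(n,d)`. -/
def dA (i : Fin n) (α : Fin d) : S n d := (Matrix.single i α 1, 0)

/-- The tangent vector `∂/∂B_{αi}` of `S(n,d)`. -/
def dB (α : Fin d) (i : Fin n) : S n d := (0, Matrix.single α i 1)

/-- The value at `x` of the bivector field on `S(n,d)` belonging to `{ , }_κ`, evaluated on the
covectors `u` and `v`: the antisymmetric bilinear form determined by the brackets of the matrix
entries of `A` and `B`. -/
def poissonTensor (κ : ℂ) (x : S n d) (u v : S n d →L[ℂ] ℂ) : ℂ :=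
  (∑ i : Fin n, ∑ α : Fin d, ∑ j : Fin n, ∑ β : Fin d,
      u (dA i α) * v (dA j β) * brAA κ x (i, j) (α, β))
  + (∑ α : Fin d, ∑ i : Fin n, ∑ β : Fin d, ∑ j : Fin n,
      u (dB α i) * v (dB β j) * brBB κ x (α, β) (i, j))
  + ∑ i : Fin n, ∑ α : Fin d, ∑ β : Fin d, ∑ j : Fin n,
      (u (dA i α) * v (dB β j) - v (dA i α) * u (dB β j)) * brAB κ x (i, β) (α, j)

/-- The Poisson bracket `{f, g}_κ` of holomorphic functions on `S(n,d)`. -/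
def bracket (κ : ℂ) (f g : S n d → ℂ) (x : S n d) : ℂ :=
  poissonTensor κ x (fderiv ℂ f x) (fderiv ℂ g x)

/-- The bracket of the product Poisson structure on `S(n,1) × ⋯ × S(n,1)` (`d` copies): the sum
over `α` of the brackets taken with respect to the `α`-th factor. -/
def prodBracket (κ : ℂ) (f g : (Fin d → S n 1) → ℂ) (x : Fin d → S n 1) : ℂ :=
  ∑ α : Fin d, poissonTensor κ (x α)
    ((fderiv ℂ f x).comp (ContinuousLinearMap.single ℂ (fun _ : Fin d => S n 1) α))
    ((fderiv ℂ g x).comp (ContinuousLinearMap.single ℂ (fun _ : Fin d => S n 1) α))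

/-! ### The factors `g_±` and the decoupling map -/

/-- The functions `G_j = 1 + ∑_{k ≥ j} a_k b_k` of `(a,b) ∈ S(n,1)`; the indices start from `0`,
so that the last one, `G n`, is `1`. -/
def G (p : S n 1) (j : ℕ) : ℂ :=
  1 + ∑ k ∈ Finset.univ.filter (fun k : Fin n => j ≤ (k : ℕ)), p.1 k 0 * p.2 0 k

/-- The upper triangular matrix `g_+(a,b)`; the square roots are principal ones. -/
def gPlus (p : S n 1) : Matrix (Fin n) (Fin n) ℂ := Matrix.of fun j k =>
  if j = k then Complex.sqrt (G p j / G p (j + 1))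
  else if j < k then p.1 j 0 * p.2 0 k / Complex.sqrt (G p k * G p (k + 1))
  else 0

/-- The lower triangular matrix `g_-(a,b)⁻¹`; the square roots are principal ones. -/
def gMinusInv (p : S n 1) : Matrix (Fin n) (Fin n) ℂ := Matrix.of fun j k =>
  if j = k then Complex.sqrt (G p j / G p (j + 1))
  else if k < j then p.1 j 0 * p.2 0 k / Complex.sqrt (G p j * G p (j + 1))
  else 0

/-- The lower triangular matrix `g_-(a,b)`. -/
def gMinus (p : S n 1) : Matrix (Fin n) (Fin n) ℂ := (gMinusInv p)⁻¹

/-- The ordered product `g_+(x₀) g_+(x₁) ⋯ g_+(x_{k-1})`. -/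
def gPlusProd (x : Fin d → S n 1) (k : ℕ) : Matrix (Fin n) (Fin n) ℂ :=
  (((List.finRange d).take k).map fun β => gPlus (x β)).prod

/-- The ordered product `g_-(x_{k-1})⁻¹ ⋯ g_-(x₁)⁻¹ g_-(x₀)⁻¹`. -/
def gMinusInvProd (x : Fin d → S n 1) (k : ℕ) : Matrix (Fin n) (Fin n) ℂ :=
  (((List.finRange d).take k).reverse.map fun β => gMinusInv (x β)).prod

/-- The map `m : S(n,1) × ⋯ × S(n,1) → S(n,d)`. The `α`-th column of `A` is
`g_+(x₀) ⋯ g_+(x_{α-1}) a^α` and the `α`-th row of `B` is `b^α g_-(x_{α-1})⁻¹ ⋯ g_-(x₀)⁻¹`,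
where `x_α = (a^α, b^α)`; for the first index, `α = 0`, the products are empty. -/
def decouplingMap (x : Fin d → S n 1) : S n d :=
  (Matrix.of fun i α => (gPlusProd x α * (x α).1) i 0,
   Matrix.of fun α i => ((x α).2 * gMinusInvProd x α) 0 i)

/-- `𝒢_+ = g_+(a¹,b¹) ⋯ g_+(a^d,b^d)`. -/
def calGPlus (x : Fin d → S n 1) : Matrix (Fin n) (Fin n) ℂ :=
  ((List.finRange d).map fun β => gPlus (x β)).prod

/-- `𝒢_- = g_-(a¹,b¹) ⋯ g_-(a^d,b^d)`. -/
def calGMinus (x : Fin d → S n 1) : Matrix (Fin n) (Fin n) ℂ :=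
  ((List.finRange d).map fun β => gMinus (x β)).prod

/-- The neighbourhood of zero in `S(n,1) × ⋯ × S(n,1)` where all the functions `G_j` have positive
real part; there the principal branches of the square roots of `G_j / G_{j+1}` and `G_j G_{j+1}`
are holomorphic. -/
def domain (n d : ℕ) : Set (Fin d → S n 1) :=
  {x | ∀ (α : Fin d) (j : Fin n), 0 < (G (x α) j).re}

end

end S

namespace S

noncomputable section

/-! ### Principal square roots on the right half plane -/

/-! The map is built by adjoining one column and one row at a time. Let (a, b) be the first factor,
g = g_+(a, b), h = g_-⁻¹(a, b), and let (A', B') be the image of the remaining factors. Then A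
consists of the column a followed by gA', and B of the row b followed by B'h. Everything is
therefore an induction on d, and the main input about g and h is the triangular factorization gh = 1
+ ab (`gPlus_mul_gMinusInv`), which is a telescoping sum.

The Poisson property needs the brackets of the entries of g and h. They are obtained without
computing the derivative of any square root. A pair (U, W) of an upper and a lower triangular matrix
with equal diagonals is determined by Uh + gW (`eq_zero_of_mul_add_mul_eq_zero`), so the values of a
functional on dg and dh follow from its values on d(gh) = d(ab), and a proposed answer only has to
be checked (`IsFactorization.apply_eq`). With r_- = r - ½I the answers are {g₁,a₂} = -κ r_+ g₁a₂,
{h₁,a₂} = κ h₁ r_- a₂, {g₁,b₂} = κ b₂ r_+ g₁, {h₁,b₂} = -κ h₁b₂ r_-, {g₁,g₂} = κ[g₁g₂, r], {g₁,h₂} =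
κ(h₂ r_+ g₁ - g₁ r_+ h₂), {h₁,h₂} = κ[r, h₁h₂].

`IsMatrixBracket.cons` is the inductive step. The commutators move r^n from between g and A' to the
outside. One half of {g₁,h₂} cancels the inner r_+ term of {A'₁,B'₂} and the other half recreates it
outside. The constant term of {A'₁,B'₂} becomes gh = 1 + ab, whose summand ab is what the new column
and row contribute to the r_+^d term. This algebra is carried out for a bilinear form on an abstract
space of differentials and later applied to covectors.

The inverse is equally recursive: the first column and row return (a, b), and multiplication by g⁻¹
and h⁻¹ frees the rest. -/

lemma mul_mem_slitPlane_of_re_pos {z w : ℂ} (hz : 0 < z.re) (hw : 0 < w.re) :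
    z * w ∈ Complex.slitPlane := by
  rw [Complex.mem_slitPlane_iff]
  by_contra! h
  obtain ⟨h1, h2⟩ := h
  simp only [Complex.mul_re, Complex.mul_im] at h1 h2
  -- Multiplying the real part by `z.re` and eliminating `z.re * w.im` through the vanishing
  -- imaginary part gives `w.re` times |z|², which is positive.
  nlinarith [sq_nonneg z.im, mul_pos hz hw, mul_pos hz hz, sq_nonneg w.im,
    mul_nonneg hw.le (sq_nonneg z.im), mul_pos hw (mul_pos hz hz)]

lemma inv_re_pos {z : ℂ} (hz : 0 < z.re) : 0 < (z⁻¹).re := by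
  rw [Complex.inv_re]
  exact div_pos hz (Complex.normSq_pos.2 fun h => by simp [h] at hz)

lemma div_mem_slitPlane_of_re_pos {z w : ℂ} (hz : 0 < z.re) (hw : 0 < w.re) :
    z / w ∈ Complex.slitPlane := by
  rw [div_eq_mul_inv]
  exact mul_mem_slitPlane_of_re_pos hz (inv_re_pos hw)

lemma ne_zero_of_re_pos {z : ℂ} (hz : 0 < z.re) : z ≠ 0 := fun h => by simp [h] at hz

/-- Both arguments lie strictly between -π/2 and π/2, so their sum stays inside the principal range
and the logarithm is additive. -/
lemma sqrt_mul_of_re_pos {z w : ℂ} (hz : 0 < z.re) (hw : 0 < w.re) :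
    Complex.sqrt (z * w) = Complex.sqrt z * Complex.sqrt w := by
  have h1 := (Complex.abs_arg_lt_pi_div_two_iff.2 (Or.inl hz))
  have h2 := (Complex.abs_arg_lt_pi_div_two_iff.2 (Or.inl hw))
  rw [abs_lt] at h1 h2
  have hz0 := ne_zero_of_re_pos hz
  have hw0 := ne_zero_of_re_pos hw
  rw [Complex.sqrt, Complex.sqrt, Complex.sqrt, Complex.cpow_def_of_ne_zero (mul_ne_zero hz0 hw0),
    Complex.cpow_def_of_ne_zero hz0, Complex.cpow_def_of_ne_zero hw0, ← Complex.exp_add, ← add_mul,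
    Complex.log_mul hz0 hw0 (by constructor <;> linarith [h1.1, h1.2, h2.1, h2.2])]

lemma sqrt_inv_of_re_pos {z : ℂ} (hz : 0 < z.re) :
    Complex.sqrt z⁻¹ = (Complex.sqrt z)⁻¹ := by
  refine Complex.inv_cpow _ _ ?_
  have h1 := (Complex.abs_arg_lt_pi_div_two_iff.2 (Or.inl hz))
  rw [abs_lt] at h1
  linarith [h1.2, Real.pi_pos]

lemma sqrt_div_of_re_pos {z w : ℂ} (hz : 0 < z.re) (hw : 0 < w.re) :
    Complex.sqrt (z / w) = Complex.sqrt z / Complex.sqrt w := by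
  rw [div_eq_mul_inv, sqrt_mul_of_re_pos hz (inv_re_pos hw), sqrt_inv_of_re_pos hw, div_eq_mul_inv]

lemma sqrt_mul_self (z : ℂ) : Complex.sqrt z * Complex.sqrt z = z := by
  have := Complex.cpow_nat_inv_pow z (n := 2) two_ne_zero
  rw [sq] at this
  simpa [Complex.sqrt] using this

/-! ### The functions `G` and the factors of `1 + a b` -/

variable {n d : ℕ}

/-- The domain of holomorphy of the factors: all `G_j` have positive real part. -/
def factorDomain (n : ℕ) : Set (S n 1) := {p | ∀ j : Fin n, 0 < (G p j).re}

lemma sum_filter_le_eq_add (f : Fin n → ℂ) (i : Fin n) :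
    ∑ k ∈ Finset.univ.filter (fun k : Fin n => (i : ℕ) ≤ k), f k
      = f i + ∑ k ∈ Finset.univ.filter (fun k : Fin n => (i : ℕ) + 1 ≤ k), f k := by
  have : Finset.univ.filter (fun k : Fin n => (i : ℕ) ≤ k)
      = insert i (Finset.univ.filter (fun k : Fin n => (i : ℕ) + 1 ≤ k)) := by
    ext k
    simp only [Finset.mem_filter, Finset.mem_univ, true_and, Finset.mem_insert, Fin.ext_iff]
    omega
  rw [this, Finset.sum_insert (by simp)]

lemma G_eq_add (p : S n 1) (i : Fin n) : G p i = p.1 i 0 * p.2 0 i + G p (i + 1) := by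
  unfold G
  rw [sum_filter_le_eq_add]
  ring

lemma G_of_le (p : S n 1) {j : ℕ} (h : n ≤ j) : G p j = 1 := by
  unfold G
  rw [Finset.filter_false_of_mem (fun k _ => by omega)]
  simp

lemma G_re_pos {p : S n 1} (hp : p ∈ factorDomain n) (j : ℕ) : 0 < (G p j).re := by
  rcases lt_or_ge j n with h | h
  · exact hp ⟨j, h⟩
  · simp [G_of_le p h]

/-- Since a_k b_k = G_k - G_{k+1}, each summand is 1/G_{k+1} - 1/G_k and the sum telescopes. This
evaluates the tails of the entries of g_+ g_-⁻¹. -/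
lemma sum_div_G_eq {p : S n 1} (hp : p ∈ factorDomain n) (m : ℕ) :
    ∑ k ∈ Finset.univ.filter (fun k : Fin n => m ≤ k),
      p.1 k 0 * p.2 0 k / (G p k * G p (k + 1)) = 1 - 1 / G p m := by
  rcases le_or_gt n m with h | h
  · rw [Finset.filter_false_of_mem (fun k _ => by omega), G_of_le p h]
    simp
  · induction h.le using Nat.decreasingInduction with
    | self => omega
    | of_succ k hk ih =>
      have hk' : k < n := hk
      -- The induction hypothesis is available only for `k + 1 < n`; at `k + 1 = n` the sum is empty
      -- and G is 1.
      have e : ∑ l ∈ Finset.univ.filter (fun l : Fin n => k + 1 ≤ l),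
          p.1 l 0 * p.2 0 l / (G p l * G p (l + 1)) = 1 - 1 / G p (k + 1) := by
        rcases Nat.lt_or_ge (k + 1) n with h' | h'
        · exact ih h'
        · rw [Finset.filter_false_of_mem (fun k _ => by omega), G_of_le p h']
          simp
      have := sum_filter_le_eq_add (fun l : Fin n => p.1 l 0 * p.2 0 l / (G p l * G p (l + 1)))
        ⟨k, hk'⟩
      simp only at this
      rw [this, e]
      have h1 := ne_zero_of_re_pos (G_re_pos hp k)
      have h2 := ne_zero_of_re_pos (G_re_pos hp (k + 1))
      have h3 := G_eq_add p ⟨k, hk'⟩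
      simp only at h3
      field_simp
      linear_combination -h3

lemma gPlus_of_lt (p : S n 1) {j k : Fin n} (h : k < j) : gPlus p j k = 0 := by
  simp [gPlus, h.ne', h.not_gt]

lemma gMinusInv_of_lt (p : S n 1) {j k : Fin n} (h : j < k) : gMinusInv p j k = 0 := by
  simp [gMinusInv, h.ne, h.not_gt]

lemma gPlus_diag_eq (p : S n 1) (j : Fin n) : gPlus p j j = gMinusInv p j j := by
  simp [gPlus, gMinusInv]

lemma gPlus_diag_ne_zero {p : S n 1} (hp : p ∈ factorDomain n) (j : Fin n) : gPlus p j j ≠ 0 := by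
  have h : G p j / G p (j + 1) ≠ 0 :=
    div_ne_zero (ne_zero_of_re_pos (G_re_pos hp _)) (ne_zero_of_re_pos (G_re_pos hp _))
  intro h0
  have := sqrt_mul_self (G p j / G p (j + 1))
  simp only [gPlus, Matrix.of_apply, if_true] at h0
  rw [h0, mul_zero] at this
  exact h this.symm

lemma gPlus_isUnit {p : S n 1} (hp : p ∈ factorDomain n) : IsUnit (gPlus p) := by
  rw [Matrix.isUnit_iff_isUnit_det,
    Matrix.det_of_isUpperTriangular (M := gPlus p) (fun i j h => gPlus_of_lt p h),
    isUnit_iff_ne_zero,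
    Finset.prod_ne_zero_iff]
  exact fun i _ => gPlus_diag_ne_zero hp i

lemma gMinusInv_isUnit {p : S n 1} (hp : p ∈ factorDomain n) : IsUnit (gMinusInv p) := by
  rw [Matrix.isUnit_iff_isUnit_det,
    Matrix.det_of_isLowerTriangular _ (fun i j h => gMinusInv_of_lt p h), isUnit_iff_ne_zero,
    Finset.prod_ne_zero_iff]
  exact fun i _ => gPlus_diag_eq p i ▸ gPlus_diag_ne_zero hp i

/-- Let M = max(i, j). Terms with k < M vanish by triangularity, and those with k > M telescope to
a_i b_j (1 - 1/G_{M+1}). The term k = M supplies the missing a_i b_j / G_{M+1} off the diagonal, and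
G_i / G_{i+1} = 1 + a_i b_i / G_{i+1} on it. -/
lemma gPlus_mul_gMinusInv {p : S n 1} (hp : p ∈ factorDomain n) :
    gPlus p * gMinusInv p = 1 + p.1 * p.2 := by
  -- Replacing the square roots by opaque q_j with q_j² = G_j reduces the remaining identities to
  -- rational ones in the q_j.
  obtain ⟨q, hqe⟩ : ∃ q : ℕ → ℂ, ∀ j, Complex.sqrt (G p j) = q j := ⟨_, fun _ => rfl⟩
  have hs : ∀ j : ℕ, q j * q j = G p j := fun j => by rw [← hqe, sqrt_mul_self]
  have hG : ∀ j : ℕ, G p j ≠ 0 := fun j => ne_zero_of_re_pos (G_re_pos hp j)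
  have hq : ∀ j : ℕ, q j ≠ 0 := fun j h => hG j (by rw [← hs j, h, mul_zero])
  have hd : ∀ j : ℕ, Complex.sqrt (G p j / G p (j + 1)) = q j / q (j + 1) := fun j => by
    rw [sqrt_div_of_re_pos (G_re_pos hp _) (G_re_pos hp _), hqe, hqe]
  have hm : ∀ j : ℕ, Complex.sqrt (G p j * G p (j + 1)) = q j * q (j + 1) := fun j => by
    rw [sqrt_mul_of_re_pos (G_re_pos hp _) (G_re_pos hp _), hqe, hqe]
  ext i j
  have key : ∀ M : Fin n, i ≤ M → j ≤ M → (i = M ∨ j = M) →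
      (gPlus p * gMinusInv p) i j = gPlus p i M * gMinusInv p M j
        + p.1 i 0 * p.2 0 j * (1 - 1 / G p (M + 1)) := by
    intro M hi hj hM
    rw [Matrix.mul_apply, ← sum_div_G_eq hp, Finset.mul_sum,
      ← Finset.sum_filter_of_ne (p := fun k : Fin n => (M : ℕ) ≤ k), sum_filter_le_eq_add]
    · congr 1
      refine Finset.sum_congr rfl fun k hk => ?_
      simp only [Finset.mem_filter, Finset.mem_univ, true_and] at hk
      have h1 : i < k := lt_of_le_of_lt hi (Fin.lt_def.2 hk)
      have h2 : j < k := lt_of_le_of_lt hj (Fin.lt_def.2 hk)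
      simp only [gPlus, gMinusInv, Matrix.of_apply, h1.ne, h2.ne', h1, h2, if_true, if_false, hm]
      rw [← hs k, ← hs (k + 1)]
      have := hq k
      have := hq (k + 1)
      field_simp
    · intro k _ hk
      by_contra! hlt
      apply hk
      rcases hM with rfl | rfl
      · rw [gPlus_of_lt p (Fin.lt_def.2 hlt), zero_mul]
      · rw [gMinusInv_of_lt p (Fin.lt_def.2 hlt), mul_zero]
  have hr : (1 + p.1 * p.2 : Matrix (Fin n) (Fin n) ℂ) i j
      = (if i = j then 1 else 0) + p.1 i 0 * p.2 0 j := by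
    simp [Matrix.mul_apply, Matrix.one_apply]
  rw [hr]
  rcases lt_trichotomy i j with h | rfl | h
  · rw [key j h.le le_rfl (Or.inr rfl)]
    simp only [gPlus, gMinusInv, Matrix.of_apply, h.ne, h, if_true, if_false, hm, hd]
    rw [← hs (j + 1)]
    have := hq j
    have := hq (j + 1)
    field_simp
    ring
  · rw [key i le_rfl le_rfl (Or.inl rfl)]
    simp only [gPlus, gMinusInv, Matrix.of_apply, if_true]
    rw [sqrt_mul_self, G_eq_add]
    have := hG (i + 1)
    field_simp
    ring
  · rw [key i le_rfl h.le (Or.inl rfl)]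
    simp only [gPlus, gMinusInv, Matrix.of_apply, h.ne', h, if_true, if_false, hm, hd]
    rw [← hs (i + 1)]
    have := hq i
    have := hq (i + 1)
    field_simp
    ring

/-! ### Differentiability -/

lemma differentiable_fst_apply (i : Fin n) (α : Fin d) :
    Differentiable ℂ fun x : S n d => x.1 i α := by
  have h : Differentiable ℂ fun x : S n d => x.1 := differentiable_fst
  exact differentiable_pi.1 (differentiable_pi.1 h i) α

lemma differentiable_snd_apply (α : Fin d) (i : Fin n) :
    Differentiable ℂ fun x : S n d => x.2 α i := by
  have h : Differentiable ℂ fun x : S n d => x.2 := differentiable_snd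
  exact differentiable_pi.1 (differentiable_pi.1 h α) i

lemma differentiable_G (j : ℕ) : Differentiable ℂ fun p : S n 1 => G p j := by
  unfold G
  exact (differentiable_const _).add (Differentiable.fun_sum fun k _ =>
    (differentiable_fst_apply k 0).mul (differentiable_snd_apply 0 k))

lemma isOpen_factorDomain : IsOpen (factorDomain n) := by
  have : factorDomain n = ⋂ j : Fin n, {p : S n 1 | 0 < (G p j).re} := by
    ext p
    simp [factorDomain]
  rw [this]
  exact isOpen_iInter_of_finite fun j =>
    isOpen_lt continuous_const (Complex.continuous_re.comp (differentiable_G j).continuous)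

lemma differentiableAt_sqrt_comp {f : S n 1 → ℂ} {x : S n 1}
    (hf : DifferentiableAt ℂ f x) (hx : f x ∈ Complex.slitPlane) :
    DifferentiableAt ℂ (fun y => Complex.sqrt (f y)) x :=
  hf.cpow_const hx

lemma sqrt_ne_zero {z : ℂ} (hz : z ≠ 0) : Complex.sqrt z ≠ 0 := fun h =>
  hz (by rw [← sqrt_mul_self z, h, mul_zero])

lemma differentiableAt_entry_div {p : S n 1} (hp : p ∈ factorDomain n) (i j : Fin n) (k : ℕ) :
    DifferentiableAt ℂ (fun p : S n 1 => p.1 i 0 * p.2 0 j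
      / Complex.sqrt (G p k * G p (k + 1))) p := by
  have h1 : DifferentiableAt ℂ (fun p : S n 1 => G p k * G p (k + 1)) p :=
    ((differentiable_G k) p).fun_mul ((differentiable_G (k + 1)) p)
  have h2 : DifferentiableAt ℂ (fun p : S n 1 => p.1 i 0 * p.2 0 j) p :=
    ((differentiable_fst_apply i 0) p).fun_mul ((differentiable_snd_apply 0 j) p)
  simp only [div_eq_mul_inv]
  refine h2.fun_mul ((differentiableAt_sqrt_comp h1 ?_).fun_inv ?_)
  · exact mul_mem_slitPlane_of_re_pos (G_re_pos hp k) (G_re_pos hp (k + 1))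
  · exact sqrt_ne_zero (mul_ne_zero (ne_zero_of_re_pos (G_re_pos hp k))
      (ne_zero_of_re_pos (G_re_pos hp (k + 1))))

lemma differentiableAt_sqrt_div {p : S n 1} (hp : p ∈ factorDomain n) (k : ℕ) :
    DifferentiableAt ℂ (fun p : S n 1 => Complex.sqrt (G p k / G p (k + 1))) p := by
  have h1 : DifferentiableAt ℂ (fun p : S n 1 => G p k / G p (k + 1)) p := by
    simp only [div_eq_mul_inv]
    exact ((differentiable_G k) p).fun_mul (((differentiable_G (k + 1)) p).fun_inv
      (ne_zero_of_re_pos (G_re_pos hp (k + 1))))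
  exact differentiableAt_sqrt_comp h1
    (div_mem_slitPlane_of_re_pos (G_re_pos hp k) (G_re_pos hp (k + 1)))

lemma differentiableAt_gPlus_apply {p : S n 1} (hp : p ∈ factorDomain n) (i j : Fin n) :
    DifferentiableAt ℂ (fun p : S n 1 => gPlus p i j) p := by
  simp only [gPlus, Matrix.of_apply]
  split_ifs
  · exact differentiableAt_sqrt_div hp i
  · exact differentiableAt_entry_div hp i j j
  · exact differentiableAt_const _

lemma differentiableAt_gMinusInv_apply {p : S n 1} (hp : p ∈ factorDomain n) (i j : Fin n) :
    DifferentiableAt ℂ (fun p : S n 1 => gMinusInv p i j) p := by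
  simp only [gMinusInv, Matrix.of_apply]
  split_ifs
  · exact differentiableAt_sqrt_div hp i
  · exact differentiableAt_entry_div hp i j i
  · exact differentiableAt_const _

/-! ### Brackets of the triangular factors -/

/-- The coefficient of `E_{ij} ⊗ E_{ji}` in `r_+`. -/
def ordCoeff {ι : Type*} [LinearOrder ι] (i j : ι) : ℂ :=
  if i < j then 1 else if i = j then 1 / 2 else 0

section ordCoeff

variable {ι : Type*} [LinearOrder ι] {i j : ι}

lemma ordCoeff_of_lt (h : i < j) : ordCoeff i j = 1 := by simp [ordCoeff, h]

lemma ordCoeff_self (i : ι) : ordCoeff i i = 1 / 2 := by simp [ordCoeff]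

lemma ordCoeff_of_gt (h : j < i) : ordCoeff i j = 0 := by simp [ordCoeff, h.not_gt, h.ne']

lemma ordCoeff_swap (i j : ι) : ordCoeff i j = 1 - ordCoeff j i := by
  rcases lt_trichotomy i j with h | rfl | h
  · rw [ordCoeff_of_lt h, ordCoeff_of_gt h]; ring
  · rw [ordCoeff_self]; ring
  · rw [ordCoeff_of_lt h, ordCoeff_of_gt h]; ring

end ordCoeff

/-- A matrix pair `(U, W)` with `U` upper triangular, `W` lower triangular and equal diagonals is
determined by `U h + g W`. -/
lemma eq_zero_of_mul_add_mul_eq_zero {g h U W : Fin n → Fin n → ℂ}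
    (hg : ∀ j k, k < j → g j k = 0) (hh : ∀ j k, j < k → h j k = 0)
    (hd : ∀ j, g j j = h j j) (hne : ∀ j, g j j ≠ 0)
    (hU : ∀ j k, k < j → U j k = 0) (hW : ∀ j k, j < k → W j k = 0)
    (hUW : ∀ j, U j j = W j j)
    (h0 : ∀ i l, ∑ k, (U i k * h k l + g i k * W k l) = 0) (M : Fin n) :
    (∀ i, U i M = 0) ∧ (∀ l, W M l = 0) := by
  -- Downward induction: once the columns of U and the rows of W beyond M vanish, triangularity
  -- leaves a single summand in the entries of column M and row M.
  induction M using WellFoundedGT.induction with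
  | ind M ih =>
  have h1 : ∀ i, U i M * h M M + g i M * W M M = 0 := by
    intro i
    rw [← h0 i M]
    refine (Finset.sum_eq_single (f := fun k => U i k * h k M + g i k * W k M) M (fun k _ hk => ?_)
      (fun hM => absurd (Finset.mem_univ _) hM)).symm
    rcases lt_or_gt_of_ne hk with hk | hk
    · rw [hh _ _ hk, hW _ _ hk]; ring
    · rw [(ih k hk).1, (ih k hk).2]; ring
  have h2 : ∀ l, U M M * h M l + g M M * W M l = 0 := by
    intro l
    rw [← h0 M l]
    refine (Finset.sum_eq_single (f := fun k => U M k * h k l + g M k * W k l) M (fun k _ hk => ?_)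
      (fun hM => absurd (Finset.mem_univ _) hM)).symm
    rcases lt_or_gt_of_ne hk with hk | hk
    · rw [hU _ _ hk, hg _ _ hk]; ring
    · rw [(ih k hk).1, (ih k hk).2]; ring
  -- The corner entry reads 2 g_MM U_MM = 0 because both pairs have equal diagonals. Without that
  -- condition only the sum of the two diagonal contributions would be controlled.
  have h3 : U M M = 0 := by
    have := h1 M
    rw [← hUW, ← hd] at this
    have h4 : (2 * g M M) * U M M = 0 := by linear_combination this
    exact (mul_eq_zero.1 h4).resolve_left (mul_ne_zero two_ne_zero (hne M))
  have h5 : W M M = 0 := by rw [← hUW, h3]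
  refine ⟨fun i => ?_, fun l => ?_⟩
  · have := h1 i
    rw [h5, mul_zero, add_zero] at this
    exact (mul_eq_zero.1 this).resolve_right (hd M ▸ hne M)
  · have := h2 l
    rw [h3, zero_mul, zero_add] at this
    exact (mul_eq_zero.1 this).resolve_left (hne M)

variable {V : Type*} [AddCommGroup V] [Module ℂ V]

/-- A triangular factorization `1 + a b = g h` with equal diagonals, together with its
differential, the differentials being elements of a vector space `V`. -/
structure IsFactorization (a b : Fin n → ℂ) (g h : Fin n → Fin n → ℂ) (da db : Fin n → V)
    (dg dh : Fin n → Fin n → V) : Prop where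
  g_zero : ∀ j k, k < j → g j k = 0
  h_zero : ∀ j k, j < k → h j k = 0
  diag : ∀ j, g j j = h j j
  diag_ne : ∀ j, g j j ≠ 0
  mul : ∀ i l, ∑ k, g i k * h k l = (if i = l then 1 else 0) + a i * b l
  dg_zero : ∀ j k, k < j → dg j k = 0
  dh_zero : ∀ j k, j < k → dh j k = 0
  ddiag : ∀ j, dg j j = dh j j
  dmul : ∀ i l, ∑ k, (h k l • dg i k + g i k • dh k l) = a i • db l + b l • da i

namespace IsFactorization

variable {a b : Fin n → ℂ} {g h : Fin n → Fin n → ℂ} {da db : Fin n → V}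
  {dg dh : Fin n → Fin n → V}

/-- Values of a functional on the differentials of the factors are determined by its values on
the differential of the product. -/
lemma apply_eq (H : IsFactorization a b g h da db dg dh) (F : V →ₗ[ℂ] ℂ)
    (U W : Fin n → Fin n → ℂ)
    (hU : ∀ j k, k < j → U j k = 0) (hW : ∀ j k, j < k → W j k = 0)
    (hUW : ∀ j, U j j = W j j)
    (hF : ∀ i l, ∑ k, U i k * h k l + ∑ k, g i k * W k l = a i * F (db l) + b l * F (da i)) :
    (∀ i k, F (dg i k) = U i k) ∧ (∀ k l, F (dh k l) = W k l) := by
  -- The actual and the proposed values satisfy the same linear equation, so their difference solves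
  -- the homogeneous one.
  have key := eq_zero_of_mul_add_mul_eq_zero (U := fun i k => F (dg i k) - U i k)
    (W := fun k l => F (dh k l) - W k l) H.g_zero H.h_zero H.diag H.diag_ne
    (fun j k hjk => by simp [H.dg_zero j k hjk, hU j k hjk])
    (fun j k hjk => by simp [H.dh_zero j k hjk, hW j k hjk])
    (fun j => by simp [H.ddiag, hUW]) (fun i l => by
      have e1 := congrArg F (H.dmul i l)
      simp only [map_sum, map_add, map_smul, smul_eq_mul] at e1
      rw [← hF i l, ← Finset.sum_add_distrib, ← sub_eq_zero, ← Finset.sum_sub_distrib] at e1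
      rw [← e1]
      exact Finset.sum_congr rfl fun k _ => by ring)
  exact ⟨fun i k => sub_eq_zero.1 ((key k).1 i), fun k l => sub_eq_zero.1 ((key k).2 l)⟩

/-- This is g(hw) = (1 + ab)w for a column vector w. The next lemma is its counterpart for row
vectors. -/
lemma sum_mul_sum_right (H : IsFactorization a b g h da db dg dh) (w : Fin n → ℂ) (i : Fin n) :
    ∑ k, g i k * ∑ p, w p * h k p = w i + a i * ∑ p, w p * b p := by
  calc ∑ k, g i k * ∑ p, w p * h k p = ∑ p, w p * ∑ k, g i k * h k p := by
        simp only [Finset.mul_sum]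
        rw [Finset.sum_comm]
        exact Finset.sum_congr rfl fun _ _ => Finset.sum_congr rfl fun _ _ => by ring
    _ = w i + a i * ∑ p, w p * b p := by
        simp only [H.mul, mul_add, Finset.sum_add_distrib, mul_ite, mul_one, mul_zero,
          Finset.sum_ite_eq, Finset.mem_univ, if_true, Finset.mul_sum]
        congr 1
        exact Finset.sum_congr rfl fun _ _ => by ring

lemma sum_sum_mul_left (H : IsFactorization a b g h da db dg dh) (w : Fin n → ℂ) (l : Fin n) :
    ∑ k, (∑ p, w p * g p k) * h k l = w l + b l * ∑ p, w p * a p := by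
  calc ∑ k, (∑ p, w p * g p k) * h k l = ∑ p, w p * ∑ k, g p k * h k l := by
        simp only [Finset.mul_sum, Finset.sum_mul]
        rw [Finset.sum_comm]
        exact Finset.sum_congr rfl fun _ _ => Finset.sum_congr rfl fun _ _ => by ring
    _ = w l + b l * ∑ p, w p * a p := by
        simp only [H.mul, mul_add, Finset.sum_add_distrib, mul_ite, mul_one, mul_zero,
          Finset.sum_ite_eq', Finset.mem_univ, if_true, Finset.mul_sum]
        congr 1
        exact Finset.sum_congr rfl fun _ _ => by ring

end IsFactorization

/-- The brackets of the coordinates of `S(n,1)`. -/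
structure IsVectorBracket (κ : ℂ) (T : V →ₗ[ℂ] V →ₗ[ℂ] ℂ) (a b : Fin n → ℂ)
    (da db : Fin n → V) : Prop where
  antisymm : ∀ u v, T u v = -T v u
  aa : ∀ i j, T (da i) (da j) = -κ * (ordCoeff i j - 1 / 2) * (a i * a j)
  bb : ∀ i j, T (db i) (db j) = κ * (ordCoeff i j - 1 / 2) * (b i * b j)
  ab : ∀ i j, T (da i) (db j)
    = κ * ((if i = j then (∑ p, ordCoeff i p * a p * b p) + 1 else 0) + 1 / 2 * (a i * b j))

namespace IsVectorBracket

variable {κ : ℂ} {T : V →ₗ[ℂ] V →ₗ[ℂ] ℂ} {a b : Fin n → ℂ} {g h : Fin n → Fin n → ℂ}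
  {da db : Fin n → V} {dg dh : Fin n → Fin n → V}

/-- The brackets of a_j with a and b determine those with ab, hence those with g and h. In tensor
form: {g₁,a₂} = -κ r_+ g₁a₂ and {h₁,a₂} = κ h₁ r_- a₂. -/
lemma g_a_and_h_a (P : IsVectorBracket κ T a b da db) (H : IsFactorization a b g h da db dg dh)
    (j : Fin n) :
    (∀ i k, T (dg i k) (da j) = -κ * ordCoeff i j * g j k * a i) ∧
    (∀ i k, T (dh i k) (da j) =
      -κ * if j = k then ∑ p, (ordCoeff j p * a p) * h i p else 0) := by
  refine H.apply_eq (T.flip (da j)) _ (fun i k => -κ * if j = k then ∑ p, _ else 0) ?_ ?_ ?_ ?_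
  · intro i k hik
    rcases lt_or_ge j i with h1 | h1
    · rw [ordCoeff_of_gt h1]; ring
    · rw [H.g_zero j k (lt_of_lt_of_le hik h1)]; ring
  · intro i k hik
    split_ifs with h1
    · subst h1
      rw [Finset.sum_eq_zero, mul_zero]
      intro p _
      rcases lt_or_ge p j with h2 | h2
      · rw [ordCoeff_of_gt h2]; ring
      · rw [H.h_zero i p (lt_of_lt_of_le hik h2)]; ring
    · rw [mul_zero]
  · intro i
    split_ifs with h1
    · subst h1
      rw [Finset.sum_eq_single j, ordCoeff_self, H.diag]
      · ring
      · intro p _ hp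
        rcases lt_or_gt_of_ne hp with h2 | h2
        · rw [ordCoeff_of_gt h2]; ring
        · rw [H.h_zero j p h2]; ring
      · simp
    · rcases lt_or_gt_of_ne h1 with h2 | h2
      · rw [ordCoeff_of_gt h2]; ring
      · rw [H.g_zero j i h2]; ring
  · intro i l
    simp only [LinearMap.flip_apply, P.aa, P.antisymm (db _) (da _), P.ab]
    have e1 : ∑ k, -κ * ordCoeff i j * g j k * a i * h k l
        = -κ * ordCoeff i j * a i * ((if j = l then 1 else 0) + a j * b l) := by
      rw [← H.mul, Finset.mul_sum]
      exact Finset.sum_congr rfl fun _ _ => by ring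
    rw [e1]
    split_ifs with h1
    · subst h1
      have e2 : ∑ k, g i k * (-κ * ∑ p, ordCoeff j p * a p * h k p)
          = -κ * ∑ k, g i k * ∑ p, ordCoeff j p * a p * h k p := by
        rw [Finset.mul_sum]
        exact Finset.sum_congr rfl fun _ _ => by ring
      -- The two coefficients with i and j exchanged add up to 1, which matches the constant term in
      -- `P.ab`.
      rw [e2, H.sum_mul_sum_right, ordCoeff_swap j i]
      ring
    · simp only [mul_zero, Finset.sum_const_zero]
      ring

/-- The mirror image for b: {g₁,b₂} = κ b₂ r_+ g₁ and {h₁,b₂} = -κ h₁b₂ r_-. -/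
lemma g_b_and_h_b (P : IsVectorBracket κ T a b da db) (H : IsFactorization a b g h da db dg dh)
    (j : Fin n) :
    (∀ i k, T (dg i k) (db j) =
      κ * if i = j then ∑ p, (ordCoeff i p * b p) * g p k else 0) ∧
    (∀ i k, T (dh i k) (db j) = κ * ordCoeff k j * h i j * b k) := by
  refine H.apply_eq (T.flip (db j)) (fun i k => κ * if i = j then ∑ p, _ else 0) _ ?_ ?_ ?_ ?_
  · intro i k hik
    split_ifs with h1
    · subst h1
      rw [Finset.sum_eq_zero, mul_zero]
      intro p _
      rcases lt_or_ge p i with h2 | h2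
      · rw [ordCoeff_of_gt h2]; ring
      · rw [H.g_zero p k (lt_of_lt_of_le hik h2)]; ring
    · rw [mul_zero]
  · intro i k hik
    rcases lt_or_ge j k with h1 | h1
    · rw [ordCoeff_of_gt h1]; ring
    · rw [H.h_zero i j (lt_of_lt_of_le hik h1)]; ring
  · intro i
    split_ifs with h1
    · subst h1
      rw [Finset.sum_eq_single i, ordCoeff_self, H.diag]
      · ring
      · intro p _ hp
        rcases lt_or_gt_of_ne hp with h2 | h2
        · rw [ordCoeff_of_gt h2]; ring
        · rw [H.g_zero p i h2]; ring
      · simp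
    · rcases lt_or_gt_of_ne h1 with h2 | h2
      · rw [H.h_zero i j h2]; ring
      · rw [ordCoeff_of_gt h2]; ring
  · intro i l
    simp only [LinearMap.flip_apply, P.bb, P.ab]
    have e1 : ∑ k, g i k * (κ * ordCoeff l j * h k j * b l)
        = κ * ordCoeff l j * b l * ((if i = j then 1 else 0) + a i * b j) := by
      rw [← H.mul, Finset.mul_sum]
      exact Finset.sum_congr rfl fun _ _ => by ring
    rw [e1]
    split_ifs with h1
    · subst h1
      have e2 : ∑ k, (κ * ∑ p, ordCoeff i p * b p * g p k) * h k l
          = κ * ∑ k, (∑ p, ordCoeff i p * b p * g p k) * h k l := by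
        rw [Finset.mul_sum]
        exact Finset.sum_congr rfl fun _ _ => by ring
      rw [e2, H.sum_sum_mul_left, ordCoeff_swap l i]
      simp only [mul_right_comm _ (b _) (a _)]
      ring
    · simp only [mul_zero, zero_mul, Finset.sum_const_zero]
      ring

/-- Bracketing with a fixed entry of g is now known on a and b, so the uniqueness argument applies a
second time. It gives {g₁,g₂} = κ[g₁g₂, r] and {g₁,h₂} = κ(h₂ r_+ g₁ - g₁ r_+ h₂). -/
lemma g_g_and_g_h (P : IsVectorBracket κ T a b da db) (H : IsFactorization a b g h da db dg dh)
    (i k : Fin n) :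
    (∀ j l, T (dg i k) (dg j l) = κ * (ordCoeff l k - ordCoeff i j) * g i l * g j k) ∧
    (∀ j l, T (dg i k) (dh j l) =
      -κ * ((if j = k then ∑ p, (ordCoeff p k * g i p) * h p l else 0)
        - if i = l then ∑ p, (ordCoeff i p * g p k) * h j p else 0)) := by
  refine H.apply_eq (T (dg i k)) _
    (fun j l => -κ * ((if j = k then ∑ p, _ else 0) - if i = l then ∑ p, _ else 0)) ?_ ?_ ?_ ?_
  · intro j l hlj
    rcases lt_or_ge l i with h1 | h1
    · rw [H.g_zero i l h1]; ring
    rcases lt_or_ge k j with h2 | h2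
    · rw [H.g_zero j k h2]; ring
    -- Only i ≤ l < j ≤ k remains; there both coefficients are 1 and cancel.
    rw [ordCoeff_of_lt (lt_of_lt_of_le hlj h2), ordCoeff_of_lt (lt_of_le_of_lt h1 hlj)]; ring
  · intro j l hjl
    have e1 : (if j = k then ∑ p, (ordCoeff p k * g i p) * h p l else 0) = 0 := by
      split_ifs with h1
      · subst h1
        refine Finset.sum_eq_zero fun p _ => ?_
        rcases lt_or_ge j p with h2 | h2
        · rw [ordCoeff_of_gt h2]; ring
        · rw [H.h_zero p l (lt_of_le_of_lt h2 hjl)]; ring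
      · rfl
    have e2 : (if i = l then ∑ p, (ordCoeff i p * g p k) * h j p else 0) = 0 := by
      split_ifs with h1
      · subst h1
        refine Finset.sum_eq_zero fun p _ => ?_
        rcases lt_or_ge p i with h2 | h2
        · rw [ordCoeff_of_gt h2]; ring
        · rw [H.h_zero j p (lt_of_lt_of_le hjl h2)]; ring
      · rfl
    rw [e1, e2]; ring
  · intro j
    have e1 : (if j = k then ∑ p, (ordCoeff p k * g i p) * h p j else 0)
        = if j = k then 1 / 2 * g i j * g j j else 0 := by
      split_ifs with h1
      · subst h1
        rw [Finset.sum_eq_single j, ordCoeff_self, H.diag j]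
        · intro p _ hp
          rcases lt_or_gt_of_ne hp with h2 | h2
          · rw [H.h_zero p j h2]; ring
          · rw [ordCoeff_of_gt h2]; ring
        · simp
      · rfl
    have e2 : (if i = j then ∑ p, (ordCoeff i p * g p k) * h j p else 0)
        = if i = j then 1 / 2 * g j k * g j j else 0 := by
      split_ifs with h1
      · subst h1
        rw [Finset.sum_eq_single i, ordCoeff_self, H.diag i]
        · intro p _ hp
          rcases lt_or_gt_of_ne hp with h2 | h2
          · rw [ordCoeff_of_gt h2]; ring
          · rw [H.h_zero i p h2]; ring
        · simp
      · rfl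
    rw [e1, e2]
    rcases lt_trichotomy i j with h1 | h1 | h1
    · rw [ordCoeff_of_lt h1, if_neg h1.ne]
      rcases lt_trichotomy j k with h2 | h2 | h2
      · rw [ordCoeff_of_lt h2, if_neg h2.ne]; ring
      · rw [if_pos h2, ← h2, ordCoeff_self]; ring
      · rw [H.g_zero j k h2, if_neg h2.ne']; ring
    · subst h1
      rw [ordCoeff_self, if_pos rfl]
      rcases lt_trichotomy i k with h2 | h2 | h2
      · rw [ordCoeff_of_lt h2, if_neg h2.ne]; ring
      · rw [if_pos h2, ← h2, ordCoeff_self]; ring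
      · rw [H.g_zero i k h2, if_neg h2.ne']; ring
    · rw [H.g_zero i j h1, if_neg h1.ne']
      split_ifs <;> ring
  · intro j l
    rw [(P.g_a_and_h_a H j).1, (P.g_b_and_h_b H l).1]
    have e1 : ∑ m, κ * (ordCoeff m k - ordCoeff i j) * g i m * g j k * h m l
        = κ * g j k * (∑ m, (ordCoeff m k * g i m) * h m l
          - ordCoeff i j * ((if i = l then 1 else 0) + a i * b l)) := by
      rw [← H.mul, Finset.mul_sum, ← Finset.sum_sub_distrib, Finset.mul_sum]
      exact Finset.sum_congr rfl fun _ _ => by ring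
    have e2 : ∑ m, g j m * (-κ * ((if m = k then ∑ p, (ordCoeff p k * g i p) * h p l else 0)
        - if i = l then ∑ p, (ordCoeff i p * g p k) * h m p else 0))
        = -κ * g j k * ∑ p, (ordCoeff p k * g i p) * h p l
          + κ * if i = l then ordCoeff i j * g j k + a j * ∑ p, (ordCoeff i p * g p k) * b p
            else 0 := by
      have e3 : ∑ m, g j m * (-κ * if m = k then ∑ p, (ordCoeff p k * g i p) * h p l else 0)
          = -κ * g j k * ∑ p, (ordCoeff p k * g i p) * h p l := by
        rw [Finset.sum_eq_single k]
        · rw [if_pos rfl]; ring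
        · intro m _ hm
          rw [if_neg hm]; ring
        · simp
      rw [← e3]
      split_ifs with h1
      · rw [← H.sum_mul_sum_right (fun p => ordCoeff i p * g p k), Finset.mul_sum,
          ← Finset.sum_add_distrib]
        exact Finset.sum_congr rfl fun _ _ => by ring
      · simp only [sub_zero, mul_zero, add_zero]
    rw [e1, e2]
    split_ifs with h1
    · simp only [mul_right_comm _ (b _) (g _ _)]
      ring
    · ring

/-- The same argument with a fixed entry of h; the values proposed on dg are those of `g_g_and_g_h`
with the sign reversed by antisymmetry. The result is {h₁,h₂} = κ[r, h₁h₂]. -/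
lemma h_h (P : IsVectorBracket κ T a b da db) (H : IsFactorization a b g h da db dg dh)
    (i k j l : Fin n) :
    T (dh i k) (dh j l) = κ * (ordCoeff i j - ordCoeff l k) * h i l * h j k := by
  refine (H.apply_eq (T (dh i k))
    (fun j l => κ * ((if i = l then ∑ p, (ordCoeff p i * g j p) * h p k else 0)
      - if j = k then ∑ p, (ordCoeff j p * h i p) * g p l else 0))
    (fun j l => κ * (ordCoeff i j - ordCoeff l k) * h i l * h j k) ?_ ?_ ?_ ?_).2 j l
  · intro j l hlj
    have e1 : (if i = l then ∑ p, (ordCoeff p i * g j p) * h p k else 0) = 0 := by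
      split_ifs with h1
      · subst h1
        refine Finset.sum_eq_zero fun p _ => ?_
        rcases lt_or_ge i p with h2 | h2
        · rw [ordCoeff_of_gt h2]; ring
        · rw [H.g_zero j p (lt_of_le_of_lt h2 hlj)]; ring
      · rfl
    have e2 : (if j = k then ∑ p, (ordCoeff j p * h i p) * g p l else 0) = 0 := by
      split_ifs with h1
      · subst h1
        refine Finset.sum_eq_zero fun p _ => ?_
        rcases lt_or_ge p j with h2 | h2
        · rw [ordCoeff_of_gt h2]; ring
        · rw [H.g_zero p l (lt_of_lt_of_le hlj h2)]; ring
      · rfl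
    rw [e1, e2]; ring
  · intro j l hjl
    rcases lt_or_ge i l with h1 | h1
    · rw [H.h_zero i l h1]; ring
    rcases lt_or_ge j k with h2 | h2
    · rw [H.h_zero j k h2]; ring
    rw [ordCoeff_of_gt (lt_of_le_of_lt h2 hjl), ordCoeff_of_gt (lt_of_lt_of_le hjl h1)]; ring
  · intro j
    have e1 : (if i = j then ∑ p, (ordCoeff p i * g j p) * h p k else 0)
        = if i = j then 1 / 2 * h j j * h j k else 0 := by
      split_ifs with h1
      · subst h1
        rw [Finset.sum_eq_single i, ordCoeff_self, H.diag i]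
        · intro p _ hp
          rcases lt_or_gt_of_ne hp with h2 | h2
          · rw [H.g_zero i p h2]; ring
          · rw [ordCoeff_of_gt h2]; ring
        · simp
      · rfl
    have e2 : (if j = k then ∑ p, (ordCoeff j p * h i p) * g p j else 0)
        = if j = k then 1 / 2 * h j j * h i j else 0 := by
      split_ifs with h1
      · subst h1
        rw [Finset.sum_eq_single j, ordCoeff_self, H.diag j]
        · ring
        · intro p _ hp
          rcases lt_or_gt_of_ne hp with h2 | h2
          · rw [ordCoeff_of_gt h2]; ring
          · rw [H.g_zero p j h2]; ring
        · simp
      · rfl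
    rw [e1, e2]
    rcases lt_trichotomy i j with h1 | h1 | h1
    · rw [H.h_zero i j h1, if_neg h1.ne]
      split_ifs <;> ring
    · subst h1
      rw [ordCoeff_self, if_pos rfl]
      rcases lt_trichotomy i k with h2 | h2 | h2
      · rw [H.h_zero i k h2, if_neg h2.ne]; ring
      · rw [if_pos h2, ← h2, ordCoeff_self]; ring
      · rw [ordCoeff_of_gt h2, if_neg h2.ne']; ring
    · rw [ordCoeff_of_gt h1, if_neg h1.ne']
      rcases lt_trichotomy j k with h2 | h2 | h2
      · rw [H.h_zero j k h2, if_neg h2.ne]; ring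
      · rw [if_pos h2, ← h2, ordCoeff_self]; ring
      · rw [ordCoeff_of_gt h2, if_neg h2.ne']; ring
  · intro j l
    rw [(P.g_a_and_h_a H j).2, (P.g_b_and_h_b H l).2]
    have e1 : ∑ m, g j m * (κ * (ordCoeff i m - ordCoeff l k) * h i l * h m k)
        = κ * h i l * (((if j = k then 1 else 0) + a j * b k) * ordCoeff k l
          - ∑ m, (ordCoeff m i * g j m) * h m k) := by
      rw [← H.mul, Finset.sum_mul, ← Finset.sum_sub_distrib, Finset.mul_sum]
      refine Finset.sum_congr rfl fun m _ => ?_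
      rw [ordCoeff_swap i m, ordCoeff_swap l k]
      ring
    have e2 : ∑ m, (κ * ((if i = m then ∑ p, (ordCoeff p i * g j p) * h p k else 0)
        - if j = k then ∑ p, (ordCoeff j p * h i p) * g p m else 0)) * h m l
        = κ * h i l * ∑ p, (ordCoeff p i * g j p) * h p k
          - κ * if j = k then ordCoeff j l * h i l + b l * ∑ p, (ordCoeff j p * h i p) * a p
            else 0 := by
      have e3 : ∑ m, κ * (if i = m then ∑ p, (ordCoeff p i * g j p) * h p k else 0) * h m l
          = κ * h i l * ∑ p, (ordCoeff p i * g j p) * h p k := by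
        rw [Finset.sum_eq_single i]
        · rw [if_pos rfl]; ring
        · intro m _ hm
          rw [if_neg hm.symm]; ring
        · exact fun hi => absurd (Finset.mem_univ _) hi
      rw [← e3]
      split_ifs with h1
      · rw [← H.sum_sum_mul_left (fun p => ordCoeff j p * h i p), Finset.mul_sum,
          ← Finset.sum_sub_distrib]
        exact Finset.sum_congr rfl fun _ _ => by ring
      · simp only [sub_zero, mul_zero]
    rw [e1, e2]
    split_ifs with h1
    · subst h1
      simp only [mul_right_comm _ (a _) (h _ _)]
      rw [ordCoeff_swap j l]
      ring
    · ring

end IsVectorBracket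

/-! ### Adjoining a column and a row -/

/-- The brackets of the coordinates of `S(n,d)`. -/
structure IsMatrixBracket (κ : ℂ) (T : V →ₗ[ℂ] V →ₗ[ℂ] ℂ) (A : Fin n → Fin d → ℂ)
    (B : Fin d → Fin n → ℂ) (dA : Fin n → Fin d → V) (dB : Fin d → Fin n → V) : Prop where
  aa : ∀ i α j β, T (dA i α) (dA j β)
    = -κ * (ordCoeff i j - ordCoeff α β) * (A j α * A i β)
  bb : ∀ α i β j, T (dB α i) (dB β j)
    = -κ * (ordCoeff α β - ordCoeff i j) * (B α j * B β i)
  ab : ∀ i α β j, T (dA i α) (dB β j)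
    = κ * ((if i = j then ∑ p, ordCoeff i p * (A p α * B β p) else 0)
      + (if α = β then ∑ γ, ordCoeff γ α * (A i γ * B γ j) else 0)
      + (if i = j then 1 else 0) * if α = β then 1 else 0)

lemma ordCoeff_succ_succ (α β : Fin d) : ordCoeff α.succ β.succ = ordCoeff α β := by
  simp [ordCoeff]

lemma ordCoeff_zero_succ (α : Fin d) : ordCoeff 0 α.succ = 1 := ordCoeff_of_lt (Fin.succ_pos α)

lemma ordCoeff_succ_zero (α : Fin d) : ordCoeff α.succ 0 = 0 := ordCoeff_of_gt (Fin.succ_pos α)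

/-- The Leibniz rule writes the differential of an entry of gA or Bh as such a sum. The old
coordinates commute with the new factors, so the cross terms drop out. -/
lemma bilin_sum_add_sum_add (T : V →ₗ[ℂ] V →ₗ[ℂ] ℂ) {x y z t : Fin n → ℂ} {u v w s : Fin n → V}
    (h1 : ∀ p q, T (u p) (s q) = 0) (h2 : ∀ p q, T (v p) (w q) = 0) :
    T (∑ p, (x p • u p + y p • v p)) (∑ q, (z q • w q + t q • s q))
      = ∑ p, ∑ q, x p * z q * T (u p) (w q) + ∑ p, ∑ q, y p * t q * T (v p) (s q) := by
  rw [Finset.sum_comm (f := fun p q => x p * z q * T (u p) (w q)),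
    Finset.sum_comm (f := fun p q => y p * t q * T (v p) (s q)), ← Finset.sum_add_distrib]
  simp only [map_sum, LinearMap.sum_apply, map_add, map_smul, LinearMap.add_apply,
    LinearMap.smul_apply, smul_eq_mul, h1, h2, mul_zero, add_zero, zero_add, Finset.mul_sum]
  refine Finset.sum_congr rfl fun _ _ => ?_
  congr 1 <;> exact Finset.sum_congr rfl fun _ _ => by ring

lemma bilin_apply_sum_add (T : V →ₗ[ℂ] V →ₗ[ℂ] ℂ) {z t : Fin n → ℂ} {u : V} {w s : Fin n → V}
    (h1 : ∀ q, T u (w q) = 0) :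
    T u (∑ q, (z q • w q + t q • s q)) = ∑ q, t q * T u (s q) := by
  simp only [map_sum, map_add, map_smul, smul_eq_mul, h1, mul_zero, zero_add]

lemma sum_mul_sum_mul_sum {ι : Type*} [Fintype ι] (w : ι → ℂ) (x y : ι → Fin n → ℂ) :
    ∑ m, w m * ((∑ p, x m p) * ∑ q, y m q) = ∑ p, ∑ q, ∑ m, w m * (x m p * y m q) := by
  simp_rw [Finset.sum_mul_sum]
  simp only [Finset.mul_sum]
  rw [Finset.sum_comm]
  exact Finset.sum_congr rfl fun p _ => Finset.sum_comm

/-- The inductive step: the new pair becomes the column and row of index 0, while the old matrices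
are replaced by gA and Bh. The eight vanishing hypotheses say that the new variables commute with
the old ones. -/
theorem IsMatrixBracket.cons {κ : ℂ} {T : V →ₗ[ℂ] V →ₗ[ℂ] ℂ} {a b : Fin n → ℂ}
    {g h : Fin n → Fin n → ℂ} {da db : Fin n → V} {dg dh : Fin n → Fin n → V}
    {A : Fin n → Fin d → ℂ} {B : Fin d → Fin n → ℂ} {dA : Fin n → Fin d → V}
    {dB : Fin d → Fin n → V}
    (P : IsVectorBracket κ T a b da db) (H : IsFactorization a b g h da db dg dh)
    (Q : IsMatrixBracket κ T A B dA dB)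
    (aA : ∀ i j α, T (da i) (dA j α) = 0) (aB : ∀ i α j, T (da i) (dB α j) = 0)
    (bA : ∀ i j α, T (db i) (dA j α) = 0) (bB : ∀ i α j, T (db i) (dB α j) = 0)
    (gA : ∀ i k j α, T (dg i k) (dA j α) = 0) (gB : ∀ i k α j, T (dg i k) (dB α j) = 0)
    (hA : ∀ i k j α, T (dh i k) (dA j α) = 0) (hB : ∀ i k α j, T (dh i k) (dB α j) = 0) :
    IsMatrixBracket (d := d + 1) κ T
      (fun i => Fin.cons (a i) fun α => ∑ p, g i p * A p α)
      (Fin.cons b fun α i => ∑ p, B α p * h p i)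
      (fun i => Fin.cons (da i) fun α => ∑ p, (g i p • dA p α + A p α • dg i p))
      (Fin.cons db fun α i => ∑ p, (h p i • dB α p + B α p • dh p i)) := by
  have hga := fun j => (P.g_a_and_h_a H j).1
  have hha := fun j => (P.g_a_and_h_a H j).2
  have hgb := fun j => (P.g_b_and_h_b H j).1
  have hhb := fun j => (P.g_b_and_h_b H j).2
  have hgg := fun i k => (P.g_g_and_g_h H i k).1
  have hgh := fun i k => (P.g_g_and_g_h H i k).2
  have hhh := P.h_h H
  have anti := P.antisymm
  have gA' : ∀ i k j α, T (dA j α) (dg i k) = 0 := fun i k j α => by rw [anti, gA, neg_zero]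
  have hB' : ∀ i k α j, T (dB α j) (dh i k) = 0 := fun i k j α => by rw [anti, hB, neg_zero]
  have hA' : ∀ i k j α, T (dA j α) (dh i k) = 0 := fun i k j α => by rw [anti, hA, neg_zero]
  have a_A : ∀ i j β, T (da i) (∑ p, (g j p • dA p β + A p β • dg j p))
      = κ * ordCoeff j i * a j * ∑ p, g i p * A p β := fun i j β => by
    rw [bilin_apply_sum_add T fun q => aA i q β, Finset.mul_sum]
    exact Finset.sum_congr rfl fun p _ => by rw [anti, hga]; ring
  have b_B : ∀ i β j, T (db i) (∑ p, (h p j • dB β p + B β p • dh p j))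
      = -κ * ordCoeff j i * b j * ∑ p, B β p * h p i := fun i β j => by
    rw [bilin_apply_sum_add T fun q => bB i β q, Finset.mul_sum]
    exact Finset.sum_congr rfl fun p _ => by rw [anti, hhb]; ring
  refine ⟨fun i α j β => ?_, fun α i β j => ?_, fun i α β j => ?_⟩
  · refine Fin.cases ?_ (fun α => ?_) α <;> refine Fin.cases ?_ (fun β => ?_) β
    · simp only [Fin.cons_zero, P.aa, ordCoeff_self]; ring
    · simp only [Fin.cons_zero, Fin.cons_succ, a_A, ordCoeff_zero_succ]
      rw [ordCoeff_swap j i]; ring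
    · simp only [Fin.cons_zero, Fin.cons_succ]
      rw [anti, a_A, ordCoeff_succ_zero]; ring
    · simp only [Fin.cons_succ, ordCoeff_succ_succ]
      rw [bilin_sum_add_sum_add T (fun p q => gA' _ _ _ _) (fun p q => gA _ _ _ _)]
      rw [Finset.sum_comm (f := fun p q => A p α * A q β * T (dg i p) (dg j q)),
        ← Finset.sum_add_distrib, mul_comm (∑ p, g j p * A p α), Finset.sum_mul_sum, Finset.mul_sum]
      refine Finset.sum_congr rfl fun p _ => ?_
      rw [← Finset.sum_add_distrib, Finset.mul_sum]
      refine Finset.sum_congr rfl fun q _ => ?_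
      -- The summand of {g₁,g₂} with coefficient `ordCoeff p q` cancels the inner r^n term of
      -- {A₁,A₂}, leaving r^n outside g.
      rw [Q.aa, hgg]
      ring
  · refine Fin.cases ?_ (fun α => ?_) α <;> refine Fin.cases ?_ (fun β => ?_) β
    · simp only [Fin.cons_zero, P.bb, ordCoeff_self]; ring
    · simp only [Fin.cons_zero, Fin.cons_succ, b_B, ordCoeff_zero_succ]
      rw [ordCoeff_swap j i]; ring
    · simp only [Fin.cons_zero, Fin.cons_succ]
      rw [anti, b_B, ordCoeff_succ_zero]; ring
    · simp only [Fin.cons_succ, ordCoeff_succ_succ]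
      rw [bilin_sum_add_sum_add T (fun p q => hB' _ _ _ _) (fun p q => hB _ _ _ _)]
      rw [Finset.sum_comm (f := fun p q => B α p * B β q * T (dh p i) (dh q j)),
        ← Finset.sum_add_distrib, mul_comm (∑ p, B α p * h p j), Finset.sum_mul_sum, Finset.mul_sum]
      refine Finset.sum_congr rfl fun p _ => ?_
      rw [← Finset.sum_add_distrib, Finset.mul_sum]
      refine Finset.sum_congr rfl fun q _ => ?_
      rw [Q.bb, hhh, ordCoeff_swap q p, ordCoeff_swap i j]
      ring
  · refine Fin.cases ?_ (fun α => ?_) α <;> refine Fin.cases ?_ (fun β => ?_) β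
    · simp only [Fin.cons_zero, Fin.sum_univ_succ, Fin.cons_succ, P.ab, ordCoeff_self,
        ordCoeff_succ_zero, if_true, zero_mul, Finset.sum_const_zero, mul_assoc]
      split_ifs <;> ring
    · simp only [Fin.cons_zero, Fin.cons_succ, (Fin.succ_ne_zero β).symm, if_false, mul_zero,
        add_zero]
      rw [bilin_apply_sum_add T fun q => aB i β q]
      simp only [anti (da i), hha]
      split_ifs with h1
      · simp only [Finset.mul_sum, ← Finset.sum_neg_distrib]
        rw [Finset.sum_comm]
        exact Finset.sum_congr rfl fun _ _ => Finset.sum_congr rfl fun _ _ => by ring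
      · simp
    · simp only [Fin.cons_zero, Fin.cons_succ, Fin.succ_ne_zero α, if_false, mul_zero, add_zero]
      rw [anti, bilin_apply_sum_add T fun q => bA j q α]
      simp only [anti (db j), hgb]
      split_ifs with h1
      · simp only [Finset.mul_sum, Finset.sum_mul, ← Finset.sum_neg_distrib]
        rw [Finset.sum_comm]
        exact Finset.sum_congr rfl fun _ _ => Finset.sum_congr rfl fun _ _ => by ring
      · simp
    · simp only [Fin.cons_succ, Fin.succ_inj]
      rw [bilin_sum_add_sum_add T (fun p q => hA' _ _ _ _) (fun p q => gB _ _ _ _)]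
      simp only [Q.ab, hgh]
      have e1 : ∑ p, ∑ q, A p α * B β q * (-κ *
          ((if q = p then ∑ m, ordCoeff m p * g i m * h m j else 0)
            - if i = j then ∑ m, ordCoeff i m * g m p * h q m else 0))
          = -κ * (∑ p, ∑ m, A p α * B β p * (ordCoeff m p * g i m * h m j))
            + κ * if i = j then ∑ m, ordCoeff i m * ((∑ p, g m p * A p α) * ∑ q, B β q * h q m)
              else 0 := by
        have e : ∑ p, ∑ q, A p α * B β q * (-κ *
            if q = p then ∑ m, ordCoeff m p * g i m * h m j else 0)
            = -κ * (∑ p, ∑ m, A p α * B β p * (ordCoeff m p * g i m * h m j)) := by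
          rw [Finset.mul_sum]
          refine Finset.sum_congr rfl fun p _ => ?_
          rw [← Finset.mul_sum]
          simp only [mul_ite, mul_zero, Finset.sum_ite_eq', Finset.mem_univ, if_true]
          ring
        rw [← e]
        split_ifs with hij
        · have e' : ∑ m, ordCoeff i m * ((∑ p, g m p * A p α) * ∑ q, B β q * h q m)
              = ∑ p, ∑ q, A p α * B β q * ∑ m, ordCoeff i m * g m p * h q m := by
            rw [sum_mul_sum_mul_sum]
            refine Finset.sum_congr rfl fun p _ => Finset.sum_congr rfl fun q _ => ?_
            rw [Finset.mul_sum]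
            exact Finset.sum_congr rfl fun m _ => by ring
          rw [e', Finset.mul_sum, ← Finset.sum_add_distrib]
          refine Finset.sum_congr rfl fun p _ => ?_
          rw [Finset.mul_sum, ← Finset.sum_add_distrib]
          exact Finset.sum_congr rfl fun q _ => by ring
        · simp only [sub_zero, mul_zero, add_zero]
      have e2 : ∑ p, ∑ q, g i p * h q j * (κ *
          ((if p = q then ∑ m, ordCoeff p m * (A m α * B β m) else 0)
            + (if α = β then ∑ γ, ordCoeff γ α * (A p γ * B γ q) else 0)
            + (if p = q then 1 else 0) * if α = β then 1 else 0))
          = κ * (∑ p, ∑ m, g i p * h p j * (ordCoeff p m * (A m α * B β m)))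
            + κ * if α = β then (∑ γ, ordCoeff γ α * ((∑ p, g i p * A p γ) * ∑ q, B γ q * h q j))
              + ((if i = j then 1 else 0) + a i * b j) else 0 := by
        have e : ∑ p, ∑ q, g i p * h q j * (κ *
            if p = q then ∑ m, ordCoeff p m * (A m α * B β m) else 0)
            = κ * (∑ p, ∑ m, g i p * h p j * (ordCoeff p m * (A m α * B β m))) := by
          rw [Finset.mul_sum]
          refine Finset.sum_congr rfl fun p _ => ?_
          rw [← Finset.mul_sum]
          simp only [mul_ite, mul_zero, Finset.sum_ite_eq, Finset.mem_univ, if_true]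
          ring
        rw [← e]
        by_cases hαβ : α = β
        · simp only [if_pos hαβ]
          have e' : ∑ γ, ordCoeff γ α * ((∑ p, g i p * A p γ) * ∑ q, B γ q * h q j)
              = ∑ p, ∑ q, g i p * h q j * ∑ γ, ordCoeff γ α * (A p γ * B γ q) := by
            rw [sum_mul_sum_mul_sum]
            refine Finset.sum_congr rfl fun p _ => Finset.sum_congr rfl fun q _ => ?_
            rw [Finset.mul_sum]
            exact Finset.sum_congr rfl fun m _ => by ring
          -- The constant term of {A₁,B₂}, multiplied by g and h, becomes (gh)_ij = δ_ij + a_i b_j.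
          have e'' : ∑ k, g i k * h k j
              = ∑ p, ∑ q, g i p * h q j * if p = q then 1 else 0 := by
            simp
          rw [e', ← H.mul, e'', ← Finset.sum_add_distrib, Finset.mul_sum, ← Finset.sum_add_distrib]
          refine Finset.sum_congr rfl fun p _ => ?_
          rw [← Finset.sum_add_distrib, Finset.mul_sum, ← Finset.sum_add_distrib]
          exact Finset.sum_congr rfl fun q _ => by ring
        · simp only [if_neg hαβ, mul_zero, add_zero]
      have e3 : ∑ p, ∑ m, A p α * B β p * (ordCoeff m p * g i m * h m j)
          = ∑ p, ∑ m, g i p * h p j * (ordCoeff p m * (A m α * B β m)) := by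
        rw [Finset.sum_comm]
        exact Finset.sum_congr rfl fun q _ => Finset.sum_congr rfl fun m _ => by ring
      -- By `e3` the inner r_+ term of {A₁,B₂} and one half of {g₁,h₂} cancel. The left-over a_i b_j
      -- is the index-0 summand of the sum over γ, whose coefficient is 1.
      rw [e1, e2, e3]
      simp only [Fin.sum_univ_succ, Fin.cons_zero, Fin.cons_succ, ordCoeff_succ_succ,
        ordCoeff_zero_succ]
      split_ifs <;> ring

/-! ### The Poisson tensor in coordinates -/

lemma single_kronecker_single_apply {l : ℕ} (p q i j k m : Fin l) :
    (Matrix.single p q (1 : ℂ) ⊗ₖ Matrix.single q p (1 : ℂ)) (i, j) (k, m)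
      = if p = i ∧ q = j then if i = m ∧ j = k then 1 else 0 else 0 := by
  simp only [Matrix.kroneckerMap_apply, Matrix.single_apply]
  by_cases h1 : p = i <;> by_cases h2 : q = j <;> subst_vars <;> simp_all
  simp only [ite_and]

/-- The unit E_pq ⊗ E_qp has its only nonzero entry at row (p, q), column (q, p). Thus r is
supported where the column is the swapped row, with values ½, 0 or -½ according to the order. -/
lemma rMat_apply {l : ℕ} (i j k m : Fin l) :
    rMat l (i, j) (k, m) = if i = m ∧ j = k then ordCoeff i j - 1 / 2 else 0 := by
  have h' : ∀ p : Fin l, Finset.Ioi p = Finset.univ.filter (fun q => p < q) := fun p => by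
    ext; simp
  simp only [rMat, Matrix.smul_apply, Matrix.sum_apply, Matrix.sub_apply,
    single_kronecker_single_apply]
  simp only [h', Finset.sum_filter, smul_eq_mul]
  by_cases hc : i = m ∧ j = k
  · have e2 : ∀ p q : Fin l, (if p < q then
        (if p = i ∧ q = j then (1 : ℂ) else 0) - (if q = i ∧ p = j then 1 else 0) else 0)
          = (if p = i then if q = j then (if i < j then 1 else 0) else 0 else 0)
            - (if p = j then if q = i then (if j < i then 1 else 0) else 0 else 0) := by
      intro p q
      by_cases h1 : p = i <;> by_cases h2 : q = j <;> by_cases h3 : q = i <;>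
        by_cases h4 : p = j <;> by_cases h5 : p < q <;> subst_vars <;> simp_all
      split_ifs <;> simp
    simp only [if_pos hc, e2, Finset.sum_sub_distrib]
    rcases lt_trichotomy i j with h1 | h1 | h1
    · simp [ordCoeff_of_lt h1, h1, h1.not_gt]; norm_num
    · simp [h1, ordCoeff_self]
    · simp [ordCoeff_of_gt h1, h1, h1.not_gt]
  · simp [hc]

lemma iMat_apply {l : ℕ} (i j k m : Fin l) :
    iMat l (i, j) (k, m) = if i = m ∧ j = k then 1 else 0 := by
  simp only [iMat, Matrix.sum_apply, Matrix.kroneckerMap_apply, Matrix.single_apply]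
  rw [Finset.sum_eq_single i, Finset.sum_eq_single k]
  · by_cases h1 : i = m <;> by_cases h2 : j = k <;> simp_all [eq_comm]
  · intro q _ hq
    simp [hq]
  · simp
  · intro p _ hp
    simp [hp]
  · simp

lemma cMat_apply (i j : Fin n) (α β : Fin d) :
    cMat n d (i, β) (α, j) = (if i = j then 1 else 0) * if α = β then 1 else 0 := by
  simp only [cMat, Matrix.sum_apply, Matrix.kroneckerMap_apply, Matrix.single_apply]
  rw [Finset.sum_eq_single i, Finset.sum_eq_single α]
  · simp [mul_comm, ite_and]
  · intro q _ hq
    simp [hq]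
  · simp
  · intro p _ hp
    simp [hp]
  · simp

lemma rPlus_apply {l : ℕ} (i j k m : Fin l) :
    rPlus l (i, j) (k, m) = if i = m ∧ j = k then ordCoeff i j else 0 := by
  simp only [rPlus, Matrix.add_apply, Matrix.smul_apply, rMat_apply, iMat_apply]
  split_ifs <;> simp

lemma rMat_mul_apply {l : ℕ} {ι : Type*} (X : Matrix (Fin l × Fin l) ι ℂ) (i j : Fin l) (k : ι) :
    (rMat l * X) (i, j) k = (ordCoeff i j - 1 / 2) * X (j, i) k := by
  rw [Matrix.mul_apply, Finset.sum_eq_single (j, i)]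
  · simp [rMat_apply]
  · rintro ⟨p, q⟩ _ h
    rw [rMat_apply, if_neg, zero_mul]
    rintro ⟨rfl, rfl⟩
    exact h rfl
  · exact fun h => absurd (Finset.mem_univ _) h

lemma mul_rMat_apply {l : ℕ} {ι : Type*} (X : Matrix ι (Fin l × Fin l) ℂ) (i j : Fin l) (k : ι) :
    (X * rMat l) k (i, j) = X k (j, i) * (ordCoeff j i - 1 / 2) := by
  rw [Matrix.mul_apply, Finset.sum_eq_single (j, i)]
  · simp [rMat_apply]
  · rintro ⟨p, q⟩ _ h
    rw [rMat_apply, if_neg, mul_zero]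
    rintro ⟨rfl, rfl⟩
    exact h rfl
  · exact fun h => absurd (Finset.mem_univ _) h

lemma rPlus_mul_apply {l : ℕ} {ι : Type*} (X : Matrix (Fin l × Fin l) ι ℂ) (i j : Fin l) (k : ι) :
    (rPlus l * X) (i, j) k = ordCoeff i j * X (j, i) k := by
  rw [Matrix.mul_apply, Finset.sum_eq_single (j, i)]
  · simp [rPlus_apply]
  · rintro ⟨p, q⟩ _ h
    rw [rPlus_apply, if_neg, zero_mul]
    rintro ⟨rfl, rfl⟩
    exact h rfl
  · exact fun h => absurd (Finset.mem_univ _) h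

/-- The halves separating r from r_+ cancel between the n-side and the d-side, so the coefficients
of r_+ alone suffice. -/
lemma brAA_apply (κ : ℂ) (x : S n d) (i j : Fin n) (α β : Fin d) :
    brAA κ x (i, j) (α, β) = -κ * (ordCoeff i j - ordCoeff α β) * (x.1 j α * x.1 i β) := by
  simp only [brAA, Matrix.smul_apply, Matrix.add_apply, rMat_mul_apply, mul_rMat_apply,
    Matrix.kroneckerMap_apply, smul_eq_mul]
  rw [ordCoeff_swap β α]
  ring

lemma brBB_apply (κ : ℂ) (x : S n d) (i j : Fin n) (α β : Fin d) :
    brBB κ x (α, β) (i, j) = -κ * (ordCoeff α β - ordCoeff i j) * (x.2 α j * x.2 β i) := by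
  simp only [brBB, Matrix.smul_apply, Matrix.add_apply, rMat_mul_apply, mul_rMat_apply,
    Matrix.kroneckerMap_apply, smul_eq_mul]
  rw [ordCoeff_swap j i]
  ring

lemma brAB_apply (κ : ℂ) (x : S n d) (i j : Fin n) (α β : Fin d) :
    brAB κ x (i, β) (α, j)
      = κ * ((if i = j then ∑ p, ordCoeff i p * (x.1 p α * x.2 β p) else 0)
      + (if α = β then ∑ γ, ordCoeff γ α * (x.1 i γ * x.2 γ j) else 0)
      + (if i = j then 1 else 0) * if α = β then 1 else 0) := by
  simp only [brAB, Matrix.smul_apply, Matrix.add_apply, cMat_apply, smul_eq_mul]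
  congr 3
  · rw [Matrix.mul_assoc, Matrix.mul_apply, Fintype.sum_prod_type, Finset.sum_eq_single i]
    · split_ifs with h
      · subst h
        simp only [rPlus_mul_apply, Matrix.kroneckerMap_apply, Matrix.one_apply_eq]
        exact Finset.sum_congr rfl fun _ _ => by ring
      · simp [rPlus_mul_apply, h]
    · intro k _ hk
      simp [hk.symm]
    · simp
  · rw [Matrix.mul_assoc, Matrix.mul_apply, Fintype.sum_prod_type_right, Finset.sum_eq_single β]
    · split_ifs with h
      · subst h
        simp only [rPlus_mul_apply, Matrix.kroneckerMap_apply, Matrix.one_apply_eq]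
        exact Finset.sum_congr rfl fun _ _ => by ring
      · simp [rPlus_mul_apply, Ne.symm h]
    · intro k _ hk
      simp [hk.symm]
    · simp

/-! ### The Poisson tensor as a bilinear form on covectors -/

/-- Evaluation of covectors at a tangent vector. -/
def evalAt (a : S n d) : (S n d →L[ℂ] ℂ) →ₗ[ℂ] ℂ where
  toFun u := u a
  map_add' _ _ := rfl
  map_smul' _ _ := rfl

/-- The Poisson tensor at `x` as a bilinear form on the dual space. -/
def poissonForm (κ : ℂ) (x : S n d) : (S n d →L[ℂ] ℂ) →ₗ[ℂ] (S n d →L[ℂ] ℂ) →ₗ[ℂ] ℂ :=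
  (∑ i : Fin n, ∑ α : Fin d, ∑ j : Fin n, ∑ β : Fin d,
      brAA κ x (i, j) (α, β) • (evalAt (dA i α)).smulRight (evalAt (dA j β)))
  + (∑ α : Fin d, ∑ i : Fin n, ∑ β : Fin d, ∑ j : Fin n,
      brBB κ x (α, β) (i, j) • (evalAt (dB α i)).smulRight (evalAt (dB β j)))
  + ∑ i : Fin n, ∑ α : Fin d, ∑ β : Fin d, ∑ j : Fin n,
      brAB κ x (i, β) (α, j) • ((evalAt (dA i α)).smulRight (evalAt (dB β j))
        - (evalAt (dB β j)).smulRight (evalAt (dA i α)))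

lemma evalAt_apply (a : S n d) (u : S n d →L[ℂ] ℂ) : evalAt a u = u a := rfl

lemma poissonForm_apply (κ : ℂ) (x : S n d) (u v : S n d →L[ℂ] ℂ) :
    poissonForm κ x u v = poissonTensor κ x u v := by
  simp only [poissonForm, poissonTensor, LinearMap.add_apply, LinearMap.sum_apply,
    LinearMap.smul_apply, LinearMap.sub_apply, LinearMap.smulRight_apply, evalAt_apply, smul_eq_mul]
  simp only [mul_comm]

lemma brAA_swap (κ : ℂ) (x : S n d) (i j : Fin n) (α β : Fin d) :
    brAA κ x (j, i) (β, α) = -brAA κ x (i, j) (α, β) := by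
  rw [brAA_apply, brAA_apply, ordCoeff_swap j i, ordCoeff_swap β α]
  ring

lemma brBB_swap (κ : ℂ) (x : S n d) (i j : Fin n) (α β : Fin d) :
    brBB κ x (β, α) (j, i) = -brBB κ x (α, β) (i, j) := by
  rw [brBB_apply, brBB_apply, ordCoeff_swap j i, ordCoeff_swap β α]
  ring

lemma sum_four_swap {M N : Type*} [Fintype M] [Fintype N] (F : M → N → M → N → ℂ) :
    ∑ i, ∑ α, ∑ j, ∑ β, F i α j β = ∑ i, ∑ α, ∑ j, ∑ β, F j β i α := by
  have h : ∀ F : M → N → M → N → ℂ, ∑ i, ∑ α, ∑ j, ∑ β, F i α j β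
      = ∑ x : M × N, ∑ y : M × N, F x.1 x.2 y.1 y.2 := fun F => by
    simp only [Fintype.sum_prod_type]
  rw [h, h, Finset.sum_comm]

lemma poissonForm_antisymm (κ : ℂ) (x : S n d) (u v : S n d →L[ℂ] ℂ) :
    poissonForm κ x u v = -poissonForm κ x v u := by
  simp only [poissonForm_apply, poissonTensor, neg_add]
  refine congrArg₂ _ (congrArg₂ _ ?_ ?_) ?_
  · rw [sum_four_swap]
    simp only [← Finset.sum_neg_distrib]
    refine Finset.sum_congr rfl fun i _ => Finset.sum_congr rfl fun α _ =>
      Finset.sum_congr rfl fun j _ => Finset.sum_congr rfl fun β _ => ?_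
    rw [brAA_swap κ x]
    ring
  · rw [sum_four_swap]
    simp only [← Finset.sum_neg_distrib]
    refine Finset.sum_congr rfl fun i _ => Finset.sum_congr rfl fun α _ =>
      Finset.sum_congr rfl fun j _ => Finset.sum_congr rfl fun β _ => ?_
    rw [brBB_swap κ x]
    ring
  · simp only [← Finset.sum_neg_distrib]
    exact Finset.sum_congr rfl fun i _ => Finset.sum_congr rfl fun α _ =>
      Finset.sum_congr rfl fun j _ => Finset.sum_congr rfl fun β _ => by ring

/-- The coordinate function `A_{iα}` on `S(n,d)`. -/
def coordA (i : Fin n) (α : Fin d) : S n d →L[ℂ] ℂ :=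
  LinearMap.toContinuousLinearMap
    { toFun := fun x => x.1 i α
      map_add' := fun _ _ => rfl
      map_smul' := fun _ _ => rfl }

/-- The coordinate function `B_{αi}` on `S(n,d)`. -/
def coordB (α : Fin d) (i : Fin n) : S n d →L[ℂ] ℂ :=
  LinearMap.toContinuousLinearMap
    { toFun := fun x => x.2 α i
      map_add' := fun _ _ => rfl
      map_smul' := fun _ _ => rfl }

lemma coordA_apply (i : Fin n) (α : Fin d) (x : S n d) : coordA i α x = x.1 i α := rfl

lemma coordB_apply (α : Fin d) (i : Fin n) (x : S n d) : coordB α i x = x.2 α i := rfl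

lemma eq_sum_dA_add_sum_dB (x : S n d) :
    x = (∑ i, ∑ α, x.1 i α • dA i α) + ∑ α, ∑ i, x.2 α i • dB α i := by
  refine Prod.ext ?_ ?_
  · simp only [dA, dB, Prod.fst_add, Prod.fst_sum, Prod.smul_fst, smul_zero, Finset.sum_const_zero,
      add_zero, Matrix.smul_single, smul_eq_mul, mul_one]
    exact Matrix.matrix_eq_sum_single x.1
  · simp only [dA, dB, Prod.snd_add, Prod.snd_sum, Prod.smul_snd, smul_zero, Finset.sum_const_zero,
      zero_add, Matrix.smul_single, smul_eq_mul, mul_one]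
    exact Matrix.matrix_eq_sum_single x.2

/-- The coordinate functions form the basis dual to `dA`, `dB`. Hence a bilinear form on covectors
is determined by its values on them. -/
lemma covector_eq_sum (u : S n d →L[ℂ] ℂ) :
    u = (∑ i, ∑ α, u (dA i α) • coordA i α) + ∑ α, ∑ i, u (dB α i) • coordB α i := by
  refine ContinuousLinearMap.ext fun x => ?_
  conv_lhs => rw [eq_sum_dA_add_sum_dB x]
  simp only [map_add, map_sum, map_smul, add_apply, sum_apply, smul_apply, smul_eq_mul,
    coordA_apply, coordB_apply, mul_comm]

lemma coordA_dA (i j : Fin n) (α β : Fin d) :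
    coordA i α (dA j β) = (if j = i then 1 else 0) * if β = α then 1 else 0 := by
  simp only [coordA_apply, dA, Matrix.single_apply, ite_and, mul_ite, mul_one, mul_zero]
  split_ifs <;> rfl

lemma coordB_dB (i j : Fin n) (α β : Fin d) :
    coordB α i (dB β j) = (if β = α then 1 else 0) * if j = i then 1 else 0 := by
  simp only [coordB_apply, dB, Matrix.single_apply, ite_and, mul_ite, mul_one, mul_zero]
  split_ifs <;> rfl

lemma coordA_dB (i j : Fin n) (α β : Fin d) : coordA i α (dB β j) = 0 := rfl

lemma coordB_dA (i j : Fin n) (α β : Fin d) : coordB α i (dA j β) = 0 := rfl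

lemma isMatrixBracket_poissonForm (κ : ℂ) (x : S n d) :
    IsMatrixBracket κ (poissonForm κ x) x.1 x.2 coordA coordB := by
  refine ⟨fun i α j β => ?_, fun α i β j => ?_, fun i α β j => ?_⟩
  · rw [← brAA_apply]
    simp [poissonForm_apply, poissonTensor, coordA_dA, coordA_dB]
  · rw [← brBB_apply]
    simp [poissonForm_apply, poissonTensor, coordB_dA, coordB_dB]
  · rw [← brAB_apply]
    simp [poissonForm_apply, poissonTensor, coordA_dA, coordA_dB, coordB_dA, coordB_dB]

/-! ### The decoupling map is built recursively -/

lemma gPlusProd_zero (x : Fin d → S n 1) : gPlusProd x 0 = 1 := by simp [gPlusProd]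

lemma gMinusInvProd_zero (x : Fin d → S n 1) : gMinusInvProd x 0 = 1 := by simp [gMinusInvProd]

lemma gPlusProd_succ (x : Fin (d + 1) → S n 1) (k : ℕ) :
    gPlusProd x (k + 1) = gPlus (x 0) * gPlusProd (Fin.tail x) k := by
  simp [gPlusProd, List.finRange_succ, Fin.tail, Function.comp_def, List.map_take]

lemma gMinusInvProd_succ (x : Fin (d + 1) → S n 1) (k : ℕ) :
    gMinusInvProd x (k + 1) = gMinusInvProd (Fin.tail x) k * gMinusInv (x 0) := by
  simp [gMinusInvProd, List.finRange_succ, Fin.tail, Function.comp_def, List.map_take]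

lemma calGPlus_succ (x : Fin (d + 1) → S n 1) :
    calGPlus x = gPlus (x 0) * calGPlus (Fin.tail x) := by
  simp [calGPlus, List.finRange_succ, Fin.tail, Function.comp_def]

lemma calGMinus_succ (x : Fin (d + 1) → S n 1) :
    calGMinus x = gMinus (x 0) * calGMinus (Fin.tail x) := by
  simp [calGMinus, List.finRange_succ, Fin.tail, Function.comp_def]

/-- Every product of g_+ in a later column begins with the factor of the first pair; splitting it
off leaves the map for the tail. This is the recursion used throughout. -/
lemma decouplingMap_fst (x : Fin (d + 1) → S n 1) (i : Fin n) :
    (decouplingMap x).1 i = Fin.cons ((x 0).1 i 0)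
      fun α => ∑ p, gPlus (x 0) i p * (decouplingMap (Fin.tail x)).1 p α := by
  funext α
  refine Fin.cases ?_ (fun α => ?_) α
  · simp [decouplingMap, gPlusProd_zero]
  · simp only [decouplingMap, Matrix.of_apply, Fin.val_succ, gPlusProd_succ, Fin.cons_succ,
      Matrix.mul_assoc]
    rfl

lemma decouplingMap_snd (x : Fin (d + 1) → S n 1) :
    (decouplingMap x).2 = (Fin.cons ((x 0).2 0)
      fun α i => ∑ p, (decouplingMap (Fin.tail x)).2 α p * gMinusInv (x 0) p i :
        Fin (d + 1) → Fin n → ℂ) := by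
  funext α
  refine Fin.cases ?_ (fun α => ?_) α
  · funext i
    simp [decouplingMap, gMinusInvProd_zero]
  · funext i
    simp only [decouplingMap, Matrix.of_apply, Fin.val_succ, gMinusInvProd_succ, Fin.cons_succ,
      ← Matrix.mul_assoc]
    rfl

lemma mem_domain_succ {x : Fin (d + 1) → S n 1} :
    x ∈ domain n (d + 1) ↔ x 0 ∈ factorDomain n ∧ Fin.tail x ∈ domain n d := by
  simp [domain, factorDomain, Fin.forall_fin_succ, Fin.tail]

/-- By the recursion, AB = ab + gA'B'h. Together with 1 + ab = gh this gives 1 + AB = g(1 + A'B')h,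
to which the induction hypothesis applies. -/
lemma one_add_decouplingMap_mul (x : Fin d → S n 1) (hx : x ∈ domain n d) :
    IsUnit (calGPlus x) ∧ IsUnit (calGMinus x) ∧
      1 + (decouplingMap x).1 * (decouplingMap x).2 = calGPlus x * (calGMinus x)⁻¹ := by
  induction d with
  | zero =>
    refine ⟨by simp [calGPlus], by simp [calGMinus], ?_⟩
    have : (decouplingMap x).1 * (decouplingMap x).2 = 0 := by
      ext i j
      simp [Matrix.mul_apply]
    simp [this, calGPlus, calGMinus]
  | succ d ih =>
    obtain ⟨h0, ht⟩ := mem_domain_succ.1 hx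
    obtain ⟨ih1, ih2, ih3⟩ := ih _ ht
    have hu : IsUnit (gMinus (x 0)) := by
      rw [gMinus, Matrix.isUnit_nonsing_inv_iff]
      exact gMinusInv_isUnit h0
    refine ⟨?_, ?_, ?_⟩
    · rw [calGPlus_succ]
      exact (gPlus_isUnit h0).mul ih1
    · rw [calGMinus_succ]
      exact hu.mul ih2
    · have e : (decouplingMap x).1 * (decouplingMap x).2
          = (x 0).1 * (x 0).2 + gPlus (x 0) * ((decouplingMap (Fin.tail x)).1
            * (decouplingMap (Fin.tail x)).2) * gMinusInv (x 0) := by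
        ext i j
        rw [Matrix.add_apply, Matrix.mul_apply, Fin.sum_univ_succ, decouplingMap_snd,
          decouplingMap_fst]
        simp only [Fin.cons_zero, Fin.cons_succ]
        rw [← Matrix.mul_assoc, Matrix.mul_assoc (_ * _), Matrix.mul_apply, Matrix.mul_apply]
        simp [Matrix.mul_apply]
      rw [e, ← add_assoc, ← gPlus_mul_gMinusInv h0, calGPlus_succ, calGMinus_succ,
        Matrix.mul_inv_rev, gMinus, Matrix.nonsing_inv_nonsing_inv _
          ((Matrix.isUnit_iff_isUnit_det _).1 (gMinusInv_isUnit h0)),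
        Matrix.mul_assoc (gPlus _) (calGPlus _), ← Matrix.mul_assoc (calGPlus _), ← ih3,
        ← Matrix.mul_assoc (gPlus _) (1 + _), Matrix.mul_add, Matrix.mul_one, Matrix.add_mul]

/-! ### Derivatives -/

/-- Projection to the first factor. -/
def headL (n d : ℕ) : (Fin (d + 1) → S n 1) →L[ℂ] S n 1 := ContinuousLinearMap.proj 0

/-- Projection to all factors but the first. -/
def tailL (n d : ℕ) : (Fin (d + 1) → S n 1) →L[ℂ] (Fin d → S n 1) :=
  ContinuousLinearMap.pi fun α => ContinuousLinearMap.proj α.succ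

/-- The differential of an entry of `A` under the decoupling map. -/
def diffA (x : Fin d → S n 1) (i : Fin n) (α : Fin d) : (Fin d → S n 1) →L[ℂ] ℂ :=
  fderiv ℂ (fun y => (decouplingMap y).1 i α) x

/-- The differential of an entry of `B` under the decoupling map. -/
def diffB (x : Fin d → S n 1) (α : Fin d) (i : Fin n) : (Fin d → S n 1) →L[ℂ] ℂ :=
  fderiv ℂ (fun y => (decouplingMap y).2 α i) x

/-- The differential of an entry of `g_+`. -/
def diffPlus (p : S n 1) (i k : Fin n) : S n 1 →L[ℂ] ℂ := fderiv ℂ (fun q => gPlus q i k) p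

/-- The differential of an entry of `g_-⁻¹`. -/
def diffMinusInv (p : S n 1) (i k : Fin n) : S n 1 →L[ℂ] ℂ :=
  fderiv ℂ (fun q => gMinusInv q i k) p

lemma hasFDerivAt_gPlus {p : S n 1} (hp : p ∈ factorDomain n) (i k : Fin n) :
    HasFDerivAt (fun q => gPlus q i k) (diffPlus p i k) p :=
  (differentiableAt_gPlus_apply hp i k).hasFDerivAt

lemma hasFDerivAt_gMinusInv {p : S n 1} (hp : p ∈ factorDomain n) (i k : Fin n) :
    HasFDerivAt (fun q => gMinusInv q i k) (diffMinusInv p i k) p :=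
  (differentiableAt_gMinusInv_apply hp i k).hasFDerivAt

lemma hasFDerivAt_decouplingMap_zero (x : Fin (d + 1) → S n 1) (i : Fin n) :
    HasFDerivAt (fun y => (decouplingMap y).1 i 0) ((coordA i 0).comp (headL n d)) x ∧
    HasFDerivAt (fun y => (decouplingMap y).2 0 i) ((coordB 0 i).comp (headL n d)) x := by
  simp only [decouplingMap_fst, decouplingMap_snd, Fin.cons_zero]
  exact ⟨((coordA i 0).comp (headL n d)).hasFDerivAt, ((coordB 0 i).comp (headL n d)).hasFDerivAt⟩

lemma hasFDerivAt_decouplingMap_succ {x : Fin (d + 1) → S n 1} (h0 : x 0 ∈ factorDomain n)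
    (hA : ∀ i α, DifferentiableAt ℂ (fun y => (decouplingMap y).1 i α) (Fin.tail x))
    (hB : ∀ α i, DifferentiableAt ℂ (fun y => (decouplingMap y).2 α i) (Fin.tail x))
    (i : Fin n) (α : Fin d) :
    HasFDerivAt (fun y => (decouplingMap y).1 i α.succ)
      (∑ p, (gPlus (x 0) i p • (diffA (Fin.tail x) p α).comp (tailL n d)
        + (decouplingMap (Fin.tail x)).1 p α • (diffPlus (x 0) i p).comp (headL n d))) x ∧
    HasFDerivAt (fun y => (decouplingMap y).2 α.succ i)
      (∑ p, (gMinusInv (x 0) p i • (diffB (Fin.tail x) α p).comp (tailL n d)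
        + (decouplingMap (Fin.tail x)).2 α p • (diffMinusInv (x 0) p i).comp (headL n d))) x := by
  simp only [decouplingMap_fst, decouplingMap_snd, Fin.cons_succ]
  constructor
  · refine HasFDerivAt.fun_sum fun p _ => ?_
    have h1 : HasFDerivAt (fun y : Fin (d + 1) → S n 1 => gPlus (y 0) i p)
        ((diffPlus (x 0) i p).comp (headL n d)) x :=
      HasFDerivAt.comp x (g := fun q => gPlus q i p) (g' := diffPlus (x 0) i p)
        (hasFDerivAt_gPlus h0 i p) (headL n d).hasFDerivAt
    have h2 : HasFDerivAt (fun y : Fin (d + 1) → S n 1 => (decouplingMap (Fin.tail y)).1 p α)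
        ((diffA (Fin.tail x) p α).comp (tailL n d)) x :=
      HasFDerivAt.comp x (hA p α).hasFDerivAt (tailL n d).hasFDerivAt
    exact h1.fun_mul h2
  · refine HasFDerivAt.fun_sum fun p _ => ?_
    have h1 : HasFDerivAt (fun y : Fin (d + 1) → S n 1 => gMinusInv (y 0) p i)
        ((diffMinusInv (x 0) p i).comp (headL n d)) x :=
      HasFDerivAt.comp x (g := fun q => gMinusInv q p i) (g' := diffMinusInv (x 0) p i)
        (hasFDerivAt_gMinusInv h0 p i) (headL n d).hasFDerivAt
    have h2 : HasFDerivAt (fun y : Fin (d + 1) → S n 1 => (decouplingMap (Fin.tail y)).2 α p)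
        ((diffB (Fin.tail x) α p).comp (tailL n d)) x :=
      HasFDerivAt.comp x (hB α p).hasFDerivAt (tailL n d).hasFDerivAt
    exact (h1.fun_mul h2).congr_of_eventuallyEq (Filter.Eventually.of_forall fun y => mul_comm _ _)

lemma differentiableAt_decouplingMap_apply {x : Fin d → S n 1} (hx : x ∈ domain n d) :
    (∀ i α, DifferentiableAt ℂ (fun y => (decouplingMap y).1 i α) x) ∧
    (∀ α i, DifferentiableAt ℂ (fun y => (decouplingMap y).2 α i) x) := by
  induction d with
  | zero => exact ⟨fun _ α => α.elim0, fun α => α.elim0⟩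
  | succ d ih =>
    obtain ⟨h0, ht⟩ := mem_domain_succ.1 hx
    obtain ⟨hA, hB⟩ := ih ht
    refine ⟨fun i α => ?_, fun α i => ?_⟩
    · refine Fin.cases ?_ (fun α => ?_) α
      · exact (hasFDerivAt_decouplingMap_zero x i).1.differentiableAt
      · exact (hasFDerivAt_decouplingMap_succ h0 hA hB i α).1.differentiableAt
    · refine Fin.cases ?_ (fun α => ?_) α
      · exact (hasFDerivAt_decouplingMap_zero x i).2.differentiableAt
      · exact (hasFDerivAt_decouplingMap_succ h0 hA hB i α).2.differentiableAt

lemma differentiableAt_decouplingMap {x : Fin d → S n 1} (hx : x ∈ domain n d) :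
    DifferentiableAt ℂ (decouplingMap (n := n) (d := d)) x := by
  obtain ⟨hA, hB⟩ := differentiableAt_decouplingMap_apply hx
  have h1 : DifferentiableAt ℂ (fun y => (decouplingMap y).1) x :=
    differentiableAt_pi.2 fun i => differentiableAt_pi.2 fun α => hA i α
  have h2 : DifferentiableAt ℂ (fun y => (decouplingMap y).2) x :=
    differentiableAt_pi.2 fun α => differentiableAt_pi.2 fun i => hB α i
  exact h1.prodMk h2

/-! ### The product Poisson structure -/

/-- Restriction of a covector to the `α`-th factor. -/
def restrictCovector (α : Fin d) :
    ((Fin d → S n 1) →L[ℂ] ℂ) →ₗ[ℂ] (S n 1 →L[ℂ] ℂ) where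
  toFun u := u.comp (ContinuousLinearMap.single ℂ (fun _ : Fin d => S n 1) α)
  map_add' _ _ := rfl
  map_smul' _ _ := rfl

lemma restrictCovector_apply (α : Fin d) (u : (Fin d → S n 1) →L[ℂ] ℂ) (v : S n 1) :
    restrictCovector α u v = u (Pi.single α v) := rfl

/-- The product Poisson tensor at `x` as a bilinear form on the dual space. -/
def prodForm (κ : ℂ) (x : Fin d → S n 1) :
    ((Fin d → S n 1) →L[ℂ] ℂ) →ₗ[ℂ] ((Fin d → S n 1) →L[ℂ] ℂ) →ₗ[ℂ] ℂ :=
  ∑ α, (poissonForm κ (x α)).compl₁₂ (restrictCovector α) (restrictCovector α)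

lemma prodForm_apply (κ : ℂ) (x : Fin d → S n 1) (u v : (Fin d → S n 1) →L[ℂ] ℂ) :
    prodForm κ x u v
      = ∑ α, poissonForm κ (x α) (restrictCovector α u) (restrictCovector α v) := by
  simp [prodForm, LinearMap.sum_apply]

lemma prodForm_antisymm (κ : ℂ) (x : Fin d → S n 1) (u v : (Fin d → S n 1) →L[ℂ] ℂ) :
    prodForm κ x u v = -prodForm κ x v u := by
  rw [prodForm_apply, prodForm_apply, ← Finset.sum_neg_distrib]
  exact Finset.sum_congr rfl fun α _ => poissonForm_antisymm _ _ _ _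

lemma restrictCovector_zero_head (u : S n 1 →L[ℂ] ℂ) :
    restrictCovector 0 (u.comp (headL n d)) = u := by
  refine ContinuousLinearMap.ext fun v => ?_
  simp [restrictCovector_apply, headL]

lemma restrictCovector_succ_head (u : S n 1 →L[ℂ] ℂ) (α : Fin d) :
    restrictCovector α.succ (u.comp (headL n d)) = 0 := by
  refine ContinuousLinearMap.ext fun v => ?_
  simp [restrictCovector_apply, headL]

lemma restrictCovector_zero_tail (u : (Fin d → S n 1) →L[ℂ] ℂ) :
    restrictCovector 0 (u.comp (tailL n d)) = 0 := by
  refine ContinuousLinearMap.ext fun v => ?_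
  have : tailL n d (Pi.single 0 v) = 0 := by
    funext α
    simp [tailL]
  simp [restrictCovector_apply, this]

lemma restrictCovector_succ_tail (u : (Fin d → S n 1) →L[ℂ] ℂ) (α : Fin d) :
    restrictCovector α.succ (u.comp (tailL n d)) = restrictCovector α u := by
  refine ContinuousLinearMap.ext fun v => ?_
  have : tailL n d (Pi.single α.succ v) = Pi.single α v := by
    funext β
    simp [tailL, Pi.single_apply]
  simp [restrictCovector_apply, this]

lemma prodForm_head_head (κ : ℂ) (x : Fin (d + 1) → S n 1) (u v : S n 1 →L[ℂ] ℂ) :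
    prodForm κ x (u.comp (headL n d)) (v.comp (headL n d)) = poissonForm κ (x 0) u v := by
  simp [prodForm_apply, Fin.sum_univ_succ, restrictCovector_zero_head, restrictCovector_succ_head]

lemma prodForm_tail_tail (κ : ℂ) (x : Fin (d + 1) → S n 1) (u v : (Fin d → S n 1) →L[ℂ] ℂ) :
    prodForm κ x (u.comp (tailL n d)) (v.comp (tailL n d)) = prodForm κ (Fin.tail x) u v := by
  simp [prodForm_apply, Fin.sum_univ_succ, restrictCovector_zero_tail, restrictCovector_succ_tail,
    Fin.tail]

lemma prodForm_head_tail (κ : ℂ) (x : Fin (d + 1) → S n 1) (u : S n 1 →L[ℂ] ℂ)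
    (v : (Fin d → S n 1) →L[ℂ] ℂ) :
    prodForm κ x (u.comp (headL n d)) (v.comp (tailL n d)) = 0 := by
  simp [prodForm_apply, Fin.sum_univ_succ, restrictCovector_zero_tail, restrictCovector_succ_head]

/-! ### The Poisson property -/

/-- The case d = 1 of the matrix brackets: the single column index has coefficient ½ with itself,
which produces the halves in `IsVectorBracket`. -/
lemma isVectorBracket_head (κ : ℂ) (x : Fin (d + 1) → S n 1) :
    IsVectorBracket κ (prodForm κ x) (fun i => (x 0).1 i 0) ((x 0).2 0)
      (fun i => (coordA i 0).comp (headL n d)) (fun i => (coordB 0 i).comp (headL n d)) := by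
  have h := isMatrixBracket_poissonForm κ (x 0)
  refine ⟨prodForm_antisymm κ x, fun i j => ?_, fun i j => ?_, fun i j => ?_⟩
  · rw [prodForm_head_head, h.aa, ordCoeff_self]
    ring
  · rw [prodForm_head_head, h.bb, ordCoeff_self]
    ring
  · rw [prodForm_head_head, h.ab]
    simp only [if_true, Fin.sum_univ_one, Fin.isValue, ordCoeff_self, mul_one, mul_assoc]
    split_ifs <;> ring

/-- The relations between the differentials come from differentiating the identities that g and h
satisfy: vanishing triangles, equal diagonals and gh = 1 + ab. -/
lemma isFactorization_diff {p : S n 1} (hp : p ∈ factorDomain n) :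
    IsFactorization (fun i => p.1 i 0) (p.2 0) (gPlus p) (gMinusInv p)
      (fun i => coordA i 0) (fun i => coordB 0 i) (diffPlus p) (diffMinusInv p) := by
  have hmul : ∀ q ∈ factorDomain n, ∀ i l, ∑ k, gPlus q i k * gMinusInv q k l
      = (if i = l then 1 else 0) + q.1 i 0 * q.2 0 l := fun q hq i l => by
    have := congrFun (congrFun (gPlus_mul_gMinusInv hq) i) l
    rw [Matrix.mul_apply, Matrix.add_apply, Matrix.mul_apply, Fin.sum_univ_one,
      Matrix.one_apply] at this
    exact this
  refine ⟨fun j k => gPlus_of_lt p, fun j k => gMinusInv_of_lt p, gPlus_diag_eq p,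
    gPlus_diag_ne_zero hp, hmul p hp, fun j k hjk => ?_, fun j k hjk => ?_, fun j => ?_,
    fun i l => ?_⟩
  · simp only [diffPlus, gPlus_of_lt _ hjk]
    exact fderiv_const_apply _
  · simp only [diffMinusInv, gMinusInv_of_lt _ hjk]
    exact fderiv_const_apply _
  · simp only [diffPlus, diffMinusInv, gPlus_diag_eq]
  · have h1 : HasFDerivAt (fun q : S n 1 => ∑ k, gMinusInv q k l * gPlus q i k)
        (∑ k, (gMinusInv p k l • diffPlus p i k + gPlus p i k • diffMinusInv p k l)) p :=
      HasFDerivAt.fun_sum fun k _ =>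
        (hasFDerivAt_gMinusInv hp k l).fun_mul (hasFDerivAt_gPlus hp i k)
    have h2 : HasFDerivAt (fun q : S n 1 => (if i = l then (1 : ℂ) else 0) + q.1 i 0 * q.2 0 l)
        (p.1 i 0 • coordB 0 l + p.2 0 l • coordA i 0) p :=
      (HasFDerivAt.fun_mul (coordA i 0).hasFDerivAt (coordB 0 l).hasFDerivAt).const_add _
    -- The factorization holds only on `factorDomain n`; openness of that set makes this enough for
    -- comparing derivatives.
    refine h1.unique (h2.congr_of_eventuallyEq ?_)
    filter_upwards [isOpen_factorDomain.mem_nhds hp] with q hq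
    rw [← hmul q hq]
    exact Finset.sum_congr rfl fun k _ => mul_comm _ _

lemma isFactorization_head {x : Fin (d + 1) → S n 1} (h0 : x 0 ∈ factorDomain n) :
    IsFactorization (fun i => (x 0).1 i 0) ((x 0).2 0) (gPlus (x 0)) (gMinusInv (x 0))
      (fun i => (coordA i 0).comp (headL n d)) (fun i => (coordB 0 i).comp (headL n d))
      (fun i k => (diffPlus (x 0) i k).comp (headL n d))
      (fun i k => (diffMinusInv (x 0) i k).comp (headL n d)) := by
  have H := isFactorization_diff h0
  refine ⟨H.g_zero, H.h_zero, H.diag, H.diag_ne, H.mul, fun j k hjk => ?_, fun j k hjk => ?_,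
    fun j => ?_, fun i l => ?_⟩
  · rw [H.dg_zero j k hjk, ContinuousLinearMap.zero_comp]
  · rw [H.dh_zero j k hjk, ContinuousLinearMap.zero_comp]
  · rw [H.ddiag]
  · have := congrArg (fun u : S n 1 →L[ℂ] ℂ => u.comp (headL n d)) (H.dmul i l)
    simpa only [ContinuousLinearMap.finsetSum_comp, ContinuousLinearMap.add_comp,
      ContinuousLinearMap.smul_comp] using this

/-- The entries of the decoupling map have the brackets of the coordinates of `S(n,d)`. -/
theorem isMatrixBracket_decouplingMap (κ : ℂ) {x : Fin d → S n 1} (hx : x ∈ domain n d) :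
    IsMatrixBracket κ (prodForm κ x) (decouplingMap x).1 (decouplingMap x).2
      (diffA x) (diffB x) := by
  induction d with
  | zero =>
    exact ⟨fun _ α => α.elim0, fun α => α.elim0, fun _ α => α.elim0⟩
  | succ d ih =>
    obtain ⟨h0, ht⟩ := mem_domain_succ.1 hx
    have Q := ih ht
    obtain ⟨hA, hB⟩ := differentiableAt_decouplingMap_apply ht
    have Q' : IsMatrixBracket κ (prodForm κ x) (decouplingMap (Fin.tail x)).1
        (decouplingMap (Fin.tail x)).2 (fun i α => (diffA (Fin.tail x) i α).comp (tailL n d))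
        (fun α i => (diffB (Fin.tail x) α i).comp (tailL n d)) :=
      ⟨fun i α j β => by rw [prodForm_tail_tail, Q.aa],
        fun α i β j => by rw [prodForm_tail_tail, Q.bb],
        fun i α β j => by rw [prodForm_tail_tail, Q.ab]⟩
    have key := IsMatrixBracket.cons (isVectorBracket_head κ x) (isFactorization_head h0) Q'
      (fun _ _ _ => prodForm_head_tail _ _ _ _) (fun _ _ _ => prodForm_head_tail _ _ _ _)
      (fun _ _ _ => prodForm_head_tail _ _ _ _) (fun _ _ _ => prodForm_head_tail _ _ _ _)
      (fun _ _ _ _ => prodForm_head_tail _ _ _ _) (fun _ _ _ _ => prodForm_head_tail _ _ _ _)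
      (fun _ _ _ _ => prodForm_head_tail _ _ _ _) (fun _ _ _ _ => prodForm_head_tail _ _ _ _)
    have edA : diffA x = fun i => Fin.cons ((coordA i 0).comp (headL n d)) fun α =>
        ∑ p, (gPlus (x 0) i p • (diffA (Fin.tail x) p α).comp (tailL n d)
          + (decouplingMap (Fin.tail x)).1 p α • (diffPlus (x 0) i p).comp (headL n d)) := by
      funext i α
      refine Fin.cases ?_ (fun α => ?_) α
      · exact (hasFDerivAt_decouplingMap_zero x i).1.fderiv
      · exact (hasFDerivAt_decouplingMap_succ h0 hA hB i α).1.fderiv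
    have edB : diffB x = Fin.cons (fun i => (coordB 0 i).comp (headL n d)) fun α i =>
        ∑ p, (gMinusInv (x 0) p i • (diffB (Fin.tail x) α p).comp (tailL n d)
          + (decouplingMap (Fin.tail x)).2 α p • (diffMinusInv (x 0) p i).comp (headL n d)) := by
      funext α i
      refine Fin.cases ?_ (fun α => ?_) α
      · exact (hasFDerivAt_decouplingMap_zero x i).2.fderiv
      · exact (hasFDerivAt_decouplingMap_succ h0 hA hB i α).2.fderiv
    rw [edA, edB, decouplingMap_snd, show (decouplingMap x).1 = _ from funext (decouplingMap_fst x)]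
    exact key

/-- Bilinear forms with the same values on the coordinates agree. -/
lemma bilin_ext_coord {T T' : (S n d →L[ℂ] ℂ) →ₗ[ℂ] (S n d →L[ℂ] ℂ) →ₗ[ℂ] ℂ}
    (aa : ∀ i α j β, T (coordA i α) (coordA j β) = T' (coordA i α) (coordA j β))
    (ab : ∀ i α β j, T (coordA i α) (coordB β j) = T' (coordA i α) (coordB β j))
    (ba : ∀ α i j β, T (coordB α i) (coordA j β) = T' (coordB α i) (coordA j β))
    (bb : ∀ α i β j, T (coordB α i) (coordB β j) = T' (coordB α i) (coordB β j)) : T = T' := by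
  refine LinearMap.ext₂ fun u v => ?_
  rw [covector_eq_sum u, covector_eq_sum v]
  simp only [map_add, map_sum, map_smul, LinearMap.add_apply, LinearMap.sum_apply,
    LinearMap.smul_apply, aa, ab, ba, bb]

/-- By the chain rule the claim concerns only differentials: the product tensor, pulled back along u
↦ u ∘ D, must equal the tensor at the image point. Both are bilinear, so agreement on coordinate
covectors suffices, and those are the brackets of the matrix entries. -/
theorem prodBracket_comp_decouplingMap (κ : ℂ) {x : Fin d → S n 1} (hx : x ∈ domain n d)
    {f g : S n d → ℂ} (hf : DifferentiableAt ℂ f (decouplingMap x))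
    (hg : DifferentiableAt ℂ g (decouplingMap x)) :
    prodBracket κ (f ∘ decouplingMap) (g ∘ decouplingMap) x = bracket κ f g (decouplingMap x) := by
  have hm := (differentiableAt_decouplingMap hx).hasFDerivAt
  set D := fderiv ℂ (decouplingMap (n := n) (d := d)) x with hD
  let Φ : (S n d →L[ℂ] ℂ) →ₗ[ℂ] ((Fin d → S n 1) →L[ℂ] ℂ) :=
    { toFun := fun u => u.comp D
      map_add' := fun _ _ => rfl
      map_smul' := fun _ _ => rfl }
  have hA : ∀ i α, Φ (coordA i α) = diffA x i α := fun i α =>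
    ((coordA i α).hasFDerivAt.comp x hm).fderiv.symm
  have hB : ∀ α i, Φ (coordB α i) = diffB x α i := fun α i =>
    ((coordB α i).hasFDerivAt.comp x hm).fderiv.symm
  have P := isMatrixBracket_decouplingMap κ hx
  have Q := isMatrixBracket_poissonForm κ (decouplingMap x)
  have key : (prodForm κ x).compl₁₂ Φ Φ = poissonForm κ (decouplingMap x) := by
    refine bilin_ext_coord (fun i α j β => ?_) (fun i α β j => ?_) (fun α i j β => ?_)
      (fun α i β j => ?_)
    · rw [LinearMap.compl₁₂_apply, hA, hA, P.aa, Q.aa]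
    · rw [LinearMap.compl₁₂_apply, hA, hB, P.ab, Q.ab]
    · rw [LinearMap.compl₁₂_apply, hA, hB, prodForm_antisymm, poissonForm_antisymm, P.ab, Q.ab]
    · rw [LinearMap.compl₁₂_apply, hB, hB, P.bb, Q.bb]
  have e1 : fderiv ℂ (f ∘ decouplingMap) x = Φ (fderiv ℂ f (decouplingMap x)) :=
    (hf.hasFDerivAt.comp x hm).fderiv
  have e2 : fderiv ℂ (g ∘ decouplingMap) x = Φ (fderiv ℂ g (decouplingMap x)) :=
    (hg.hasFDerivAt.comp x hm).fderiv
  rw [bracket, ← poissonForm_apply, ← key, LinearMap.compl₁₂_apply, ← e1, ← e2, prodForm_apply,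
    prodBracket]
  exact Finset.sum_congr rfl fun α _ => (poissonForm_apply _ _ _ _).symm

/-! ### The inverse of the decoupling map -/

/-- The first column of `A` and the first row of `B`. -/
def firstPart (y : S n (d + 1)) : S n 1 :=
  (Matrix.of fun i _ => y.1 i 0, Matrix.of fun _ i => y.2 0 i)

/-- The remaining columns of `A` and rows of `B`, freed from the factors belonging to the first
column and row. -/
def residualPart (y : S n (d + 1)) : S n d :=
  ((gPlus (firstPart y))⁻¹ * (Matrix.of fun i α => y.1 i α.succ),
    (Matrix.of fun α i => y.2 α.succ i) * (gMinusInv (firstPart y))⁻¹)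

/-- The inverse of the decoupling map. -/
def decouplingInv : (d : ℕ) → S n d → Fin d → S n 1
  | 0, _ => fun α => α.elim0
  | d + 1, y => Fin.cons (firstPart y) (decouplingInv d (residualPart y))

/-- The image of the decoupling map. -/
def decouplingRange : (d : ℕ) → Set (S n d)
  | 0 => Set.univ
  | d + 1 => {y | firstPart y ∈ factorDomain n ∧ residualPart y ∈ decouplingRange d}

lemma firstPart_decouplingMap (x : Fin (d + 1) → S n 1) : firstPart (decouplingMap x) = x 0 := by
  refine Prod.ext ?_ ?_
  · ext i j
    rw [Subsingleton.elim j 0]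
    simp [firstPart, decouplingMap_fst]
  · ext j i
    rw [Subsingleton.elim j 0]
    simp [firstPart, decouplingMap_snd]

/-- The first column and row already determine g and h, so their inverses can be applied to the
other columns and rows. -/
lemma residualPart_decouplingMap {x : Fin (d + 1) → S n 1} (h0 : x 0 ∈ factorDomain n) :
    residualPart (decouplingMap x) = decouplingMap (Fin.tail x) := by
  have hA : (Matrix.of fun i α => (decouplingMap x).1 i α.succ : Matrix (Fin n) (Fin d) ℂ)
      = gPlus (x 0) * (decouplingMap (Fin.tail x)).1 := by
    ext i α
    simp [decouplingMap_fst, Matrix.mul_apply]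
  have hB : (Matrix.of fun α i => (decouplingMap x).2 α.succ i : Matrix (Fin d) (Fin n) ℂ)
      = (decouplingMap (Fin.tail x)).2 * gMinusInv (x 0) := by
    ext α i
    simp [decouplingMap_snd, Matrix.mul_apply]
  rw [residualPart, firstPart_decouplingMap, hA, hB, ← Matrix.mul_assoc, Matrix.mul_assoc _ _ (_)⁻¹,
    Matrix.nonsing_inv_mul _ ((Matrix.isUnit_iff_isUnit_det _).1 (gPlus_isUnit h0)),
    Matrix.mul_nonsing_inv _ ((Matrix.isUnit_iff_isUnit_det _).1 (gMinusInv_isUnit h0)),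
    Matrix.one_mul, Matrix.mul_one]

lemma decouplingMap_mem_range {x : Fin d → S n 1} (hx : x ∈ domain n d) :
    decouplingMap x ∈ decouplingRange d := by
  induction d with
  | zero => trivial
  | succ d ih =>
    obtain ⟨h0, ht⟩ := mem_domain_succ.1 hx
    refine ⟨?_, ?_⟩
    · rwa [firstPart_decouplingMap]
    · rw [residualPart_decouplingMap h0]
      exact ih ht

lemma decouplingInv_decouplingMap {x : Fin d → S n 1} (hx : x ∈ domain n d) :
    decouplingInv d (decouplingMap x) = x := by
  induction d with
  | zero => exact funext fun α => α.elim0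
  | succ d ih =>
    obtain ⟨h0, ht⟩ := mem_domain_succ.1 hx
    rw [decouplingInv, firstPart_decouplingMap, residualPart_decouplingMap h0, ih ht]
    exact Fin.cons_self_tail x

lemma decouplingInv_mem_domain {y : S n d} (hy : y ∈ decouplingRange d) :
    decouplingInv d y ∈ domain n d := by
  induction d with
  | zero => exact fun α => α.elim0
  | succ d ih =>
    refine mem_domain_succ.2 ⟨?_, ?_⟩
    · rw [decouplingInv, Fin.cons_zero]
      exact hy.1
    · rw [decouplingInv, Fin.tail_cons]
      exact ih hy.2

lemma decouplingMap_decouplingInv {y : S n d} (hy : y ∈ decouplingRange d) :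
    decouplingMap (decouplingInv d y) = y := by
  induction d with
  | zero =>
    refine Prod.ext ?_ ?_
    · ext i α
      exact α.elim0
    · ext α
      exact α.elim0
  | succ d ih =>
    have hA : gPlus (firstPart y) * (residualPart y).1 = Matrix.of fun i α => y.1 i α.succ := by
      rw [residualPart, ← Matrix.mul_assoc, Matrix.mul_nonsing_inv _
        ((Matrix.isUnit_iff_isUnit_det _).1 (gPlus_isUnit hy.1)), Matrix.one_mul]
    have hB : (residualPart y).2 * gMinusInv (firstPart y)
        = Matrix.of fun α i => y.2 α.succ i := by
      rw [residualPart, Matrix.mul_assoc, Matrix.nonsing_inv_mul _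
        ((Matrix.isUnit_iff_isUnit_det _).1 (gMinusInv_isUnit hy.1)), Matrix.mul_one]
    refine Prod.ext ?_ ?_
    · ext i α
      rw [decouplingMap_fst, decouplingInv, Fin.tail_cons, Fin.cons_zero, ih hy.2]
      refine Fin.cases ?_ (fun α => ?_) α
      · rfl
      · exact congrFun (congrFun hA i) α
    · ext α i
      rw [decouplingMap_snd, decouplingInv, Fin.tail_cons, Fin.cons_zero, ih hy.2]
      refine Fin.cases ?_ (fun α => ?_) α
      · rfl
      · exact congrFun (congrFun hB α) i

/-! ### Holomorphy of the inverse and openness of the image -/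

lemma differentiable_firstPart : Differentiable ℂ (firstPart (n := n) (d := d)) := by
  have h1 : Differentiable ℂ fun y : S n (d + 1) => (firstPart y).1 :=
    differentiable_pi.2 fun i => differentiable_pi.2 fun _ => differentiable_fst_apply i 0
  have h2 : Differentiable ℂ fun y : S n (d + 1) => (firstPart y).2 :=
    differentiable_pi.2 fun _ => differentiable_pi.2 fun i => differentiable_snd_apply 0 i
  exact h1.prodMk h2

section inverse

variable {E : Type*} [NormedAddCommGroup E] [NormedSpace ℂ E] {x : E}

lemma differentiableAt_det {M : E → Matrix (Fin n) (Fin n) ℂ}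
    (hM : ∀ i j, DifferentiableAt ℂ (fun y => M y i j) x) :
    DifferentiableAt ℂ (fun y => (M y).det) x := by
  simp only [Matrix.det_apply']
  refine DifferentiableAt.fun_sum fun σ _ => ?_
  have h : DifferentiableAt ℂ (fun y => ∏ i, M y (σ i) i) x :=
    (HasFDerivAt.finsetProd fun i _ => (hM (σ i) i).hasFDerivAt).differentiableAt
  exact h.const_mul _

/-- Cramer's rule expresses the entries of the inverse as quotients of determinants, which are
polynomials in the entries of M. -/
lemma differentiableAt_inv_apply {M : E → Matrix (Fin n) (Fin n) ℂ}
    (hM : ∀ i j, DifferentiableAt ℂ (fun y => M y i j) x) (hx : IsUnit (M x)) (i j : Fin n) :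
    DifferentiableAt ℂ (fun y => (M y)⁻¹ i j) x := by
  have h : ∀ y, (M y)⁻¹ i j = ((M y).det)⁻¹ * ((M y).updateRow j (Pi.single i 1)).det := fun y => by
    rw [Matrix.inv_def, Matrix.smul_apply, Ring.inverse_eq_inv', Matrix.adjugate_apply, smul_eq_mul]
  simp only [h]
  refine ((differentiableAt_det hM).fun_inv
    ((Matrix.isUnit_iff_isUnit_det _).1 hx).ne_zero).fun_mul (differentiableAt_det fun k l => ?_)
  simp only [Matrix.updateRow_apply]
  split_ifs
  · exact differentiableAt_const _
  · exact hM k l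

end inverse

lemma differentiableAt_residualPart {y : S n (d + 1)} (hy : firstPart y ∈ factorDomain n) :
    DifferentiableAt ℂ (residualPart (n := n) (d := d)) y := by
  have hP : ∀ i j, DifferentiableAt ℂ (fun y : S n (d + 1) => (gPlus (firstPart y))⁻¹ i j) y :=
    differentiableAt_inv_apply (fun i j => DifferentiableAt.comp y
      (g := fun q => gPlus q i j) (differentiableAt_gPlus_apply hy i j)
      (differentiable_firstPart y))
      (gPlus_isUnit hy)
  have hQ : ∀ i j, DifferentiableAt ℂ (fun y : S n (d + 1) => (gMinusInv (firstPart y))⁻¹ i j) y :=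
    differentiableAt_inv_apply (fun i j => DifferentiableAt.comp y
      (g := fun q => gMinusInv q i j) (differentiableAt_gMinusInv_apply hy i j)
      (differentiable_firstPart y)) (gMinusInv_isUnit hy)
  have h1 : DifferentiableAt ℂ (fun y : S n (d + 1) => (residualPart y).1) y := by
    refine differentiableAt_pi.2 fun i => differentiableAt_pi.2 fun α => ?_
    simp only [residualPart, Matrix.mul_apply, Matrix.of_apply]
    exact DifferentiableAt.fun_sum fun k _ => (hP i k).fun_mul (differentiable_fst_apply k α.succ y)
  have h2 : DifferentiableAt ℂ (fun y : S n (d + 1) => (residualPart y).2) y := by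
    refine differentiableAt_pi.2 fun α => differentiableAt_pi.2 fun i => ?_
    simp only [residualPart, Matrix.mul_apply, Matrix.of_apply]
    exact DifferentiableAt.fun_sum fun k _ => (differentiable_snd_apply α.succ k y).fun_mul (hQ k i)
  exact h1.prodMk h2

/-- The residual part is continuous only where the first part lies in `factorDomain n`. That set is
open, so preimages of open sets within it are open. -/
lemma isOpen_decouplingRange : IsOpen (decouplingRange d : Set (S n d)) := by
  induction d with
  | zero => exact isOpen_univ
  | succ d ih =>
    have h : IsOpen (firstPart ⁻¹' factorDomain n : Set (S n (d + 1))) :=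
      isOpen_factorDomain.preimage differentiable_firstPart.continuous
    have hc : ContinuousOn (residualPart (n := n) (d := d)) (firstPart ⁻¹' factorDomain n) :=
      fun y hy => (differentiableAt_residualPart hy).continuousAt.continuousWithinAt
    exact hc.isOpen_inter_preimage h ih

lemma differentiableAt_decouplingInv {y : S n d} (hy : y ∈ decouplingRange d) :
    DifferentiableAt ℂ (decouplingInv (n := n) d) y := by
  induction d with
  | zero => exact differentiableAt_pi.2 fun α => α.elim0
  | succ d ih =>
    refine differentiableAt_pi.2 fun α => ?_
    refine Fin.cases ?_ (fun α => ?_) α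
    · exact differentiable_firstPart y
    · exact DifferentiableAt.comp y (g := fun z => decouplingInv d z α)
        (differentiableAt_pi.1 (ih hy.2) α) (differentiableAt_residualPart hy.1)

/-! ### Assembly into a biholomorphism onto an open set -/

lemma isOpen_domain : IsOpen (domain n d) := by
  have : domain n d = ⋂ α : Fin d, {x | x α ∈ factorDomain n} := by
    ext x
    simp [domain, factorDomain]
  rw [this]
  exact isOpen_iInter_of_finite fun α => isOpen_factorDomain.preimage (continuous_apply α)

/-- The decoupling map as a homeomorphism from its domain onto an open set. -/
def decouplingHomeomorph (n d : ℕ) : OpenPartialHomeomorph (Fin d → S n 1) (S n d) where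
  toFun := decouplingMap
  invFun := decouplingInv d
  source := domain n d
  target := decouplingRange d
  map_source' _ := decouplingMap_mem_range
  map_target' _ := decouplingInv_mem_domain
  left_inv' _ := decouplingInv_decouplingMap
  right_inv' _ := decouplingMap_decouplingInv
  open_source := isOpen_domain
  open_target := isOpen_decouplingRange
  continuousOn_toFun _ hx := (differentiableAt_decouplingMap hx).continuousAt.continuousWithinAt
  continuousOn_invFun _ hy := (differentiableAt_decouplingInv hy).continuousAt.continuousWithinAt

lemma zero_mem_domain : (0 : Fin d → S n 1) ∈ domain n d := by
  intro α j
  simp [G]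

lemma decouplingMap_zero : decouplingMap (0 : Fin d → S n 1) = 0 := by
  refine Prod.ext ?_ ?_
  · ext i α
    simp [decouplingMap]
  · ext α i
    simp [decouplingMap]

end

end S

theorem theorem1 (n d : ℕ) (hn : 1 < n) (hd : 1 < d) (κ : ℂ) (hκ : κ ≠ 0) :
    ∃ e : OpenPartialHomeomorph (Fin d → S n 1) (S n d),
      -- `e` is the restriction of the map `m` to a neighbourhood of zero
      e.source = S.domain n d ∧ 0 ∈ e.source ∧ e 0 = 0 ∧
      (∀ x ∈ e.source, e x = S.decouplingMap x) ∧
      -- it is biholomorphic onto its open image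
      DifferentiableOn ℂ e e.source ∧
      DifferentiableOn ℂ e.symm e.target ∧
      -- it preserves the Poisson brackets
      (∀ x ∈ e.source, ∀ f g : S n d → ℂ,
        DifferentiableAt ℂ f (e x) → DifferentiableAt ℂ g (e x) →
          S.prodBracket κ (f ∘ e) (g ∘ e) x = S.bracket κ f g (e x)) ∧
      -- the factorization identity
      (∀ x ∈ e.source, IsUnit (S.calGPlus x) ∧ IsUnit (S.calGMinus x) ∧
        1 + (e x).1 * (e x).2 = S.calGPlus x * (S.calGMinus x)⁻¹) :=
  ⟨S.decouplingHomeomorph n d, rfl, S.zero_mem_domain, S.decouplingMap_zero, fun _ _ => rfl,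
    fun _ hx => (S.differentiableAt_decouplingMap hx).differentiableWithinAt,
    fun _ hy => (S.differentiableAt_decouplingInv hy).differentiableWithinAt,
    fun _ hx _ _ hf hg => S.prodBracket_comp_decouplingMap κ hx hf hg,
    fun x hx => S.one_add_decouplingMap_mul x hx⟩
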